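/- **Setting.** Let $d\ge 1$, let $\Theta\subset\mathbb R^d$ be compact, and for each $\theta\in\Theta$ let $\nu_\theta$ be a Borel probability measure on the set of probability vectors $w=(w(-2),w(-1),w(1))$ on the three jumps $-2,-1,1$. Let $\mathbb P^\theta=\nu_\theta^{\otimes\mathbb Z}$ be the law of an i.i.d. environment $\omega=(\omega_x)_{x\in\mathbb Z}$, with expectation $\mathbb E^\theta$. Put $a_k=\omega_k(-1)/\omega_k(1)$, $b_k=\omega_k(-2)/\omega_k(1)$, $$A_k=\begin{pmatrix}a_k&b_k&0\\a_k&b_k&1\\a_k&b_k&0\end{pmatrix},\qquad \pi(\omega)=1+\sum_{k\ge1}\mathbf e_1A_k\cdots A_1(2,1,2)^t .$$ Let $\theta^*\in\Theta$ (the true parameter) be an interior point of $\Theta$. Assume: * (C1) $\inf_{\theta\in\Theta}\mathbb E^\theta[\log\omega_0(l)]>-\infty$ for $l=-2,-1,1$ (with $\log 0=-\infty$); * (C2) for every $\theta\in\Theta$, the top Lyapunov exponent of $(A_k)$ under $\mathbb P^\theta$, i.e. the almost sure limit of $\frac1n\log\|A_0A_1\cdots A_{n-1}\|$, is negative; * (C3)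 $\mathbb E^\theta[\pi(\omega)]<\infty$ for every $\theta\in\Theta$; * (C4) $\theta\mapsto\nu_\theta$ is continuous on $\Theta$ for the weak topology; * (C5) for all $\theta,\theta'\in\Theta$: $\nu_\theta\ne\nu_{\theta'}$ if and only if $\theta\ne\theta'$. **The branching chain.** For a probability vector $w$, let an individual of type $1$ or $3$ have offspring $(a,b,0)$, and an individual of type $2$ have offspring $(a,b,1)$, with probability $\frac{(a+b)!}{a!\,b!}w(-1)^aw(-2)^bw(1)$, $a,b\in\mathbb N=\{0,1,2,\dots\}$. For $\mathbf x\in\mathbb N^3$ let $Q_{\theta}(\mathbf x,\cdot)$ be the $\nu_{\theta}(dw)$-average of the law of the total offspring of $1+x_1$ individuals of type $1$, $x_2$ of type $2$ and $x_3$ of type $3$, all reproducing independently given $w$. So $Q_\theta$ is the annealed transition kernel of the 3-type branching process in random environment with one immigrant of type $1$ per generation. For $\theta\in\Theta$ and $\mathbf z,\mathbf z'\in\mathbb N^3$ put $$\tilde\phi_\theta(\mathbf z,\mathbf z')=\log\int w(-1)^{z'_1}\,w(-2)^{z'_2}\,w(1)^{z_1+z_2+z_3+1}\,\nu_\theta(dw).$$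 **Theorem.** Assume (C1)–(C5). Then the kernel $Q_{\theta^*}$ has a unique invariant probability measure $\pi_{\theta^*}$ on $\mathbb N^3$. Let $(\widetilde{\mathbf Z}_0,\widetilde{\mathbf Z}_1)$ be the first two states of the chain with kernel $Q_{\theta^*}$ and initial law $\pi_{\theta^*}$, and write $\mathbf E^*$ for its expectation. For every $\theta\in\Theta$ the limit contrast $$l(\theta)=\mathbf E^*\big[\tilde\phi_\theta(\widetilde{\mathbf Z}_0,\widetilde{\mathbf Z}_1)\big]$$ is well defined and finite, and for every $\varepsilon>0$ $$\sup_{\theta\in\Theta:\ \|\theta-\theta^*\|\ge\varepsilon}l(\theta)<l(\theta^*)$$ (Euclidean norm; the supremum of the empty set is $-\infty$). In particular $l(\theta)<l(\theta^*)$ for every $\theta\in\Theta$ with $\theta\ne\theta^*$, so $\theta^*$ is the unique, well-separated maximiser of $l$. -/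

import Mathlib

open MeasureTheory ProbabilityTheory Filter Topology

namespace RWRE

/-- Jump law at one site: a probability vector on the jumps `-2, -1, 1`, stored in this order.
The topology (and Borel structure) of the simplex is that of weak convergence. -/
abbrev SiteLaw : Type := stdSimplex ℝ (Fin 3)

/-- `ω_x(-2)` -/
def left2 (w : SiteLaw) : ℝ := w.1 0

/-- `ω_x(-1)` -/
def left1 (w : SiteLaw) : ℝ := w.1 1

/-- `ω_x(1)` -/
def right1 (w : SiteLaw) : ℝ := w.1 2

/-- An environment on `ℤ`. -/
abbrev Env : Type := ℤ → SiteLaw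

/-- Law of the i.i.d. environment with one-site marginal `ν`. -/
noncomputable def envLaw (ν : ProbabilityMeasure SiteLaw) : Measure Env :=
  Measure.infinitePi fun _ : ℤ => (ν : Measure SiteLaw)

/-- The matrix `A_k`, a function of the jump law at site `k`. -/
noncomputable def matA (w : SiteLaw) : Matrix (Fin 3) (Fin 3) ℝ :=
  !![left1 w / right1 w, left2 w / right1 w, 0;
     left1 w / right1 w, left2 w / right1 w, 1;
     left1 w / right1 w, left2 w / right1 w, 0]

/-- `A_0 A_1 ⋯ A_{n-1}` -/
noncomputable def prodUp (ω : Env) : ℕ → Matrix (Fin 3) (Fin 3) ℝ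
  | 0 => 1
  | n + 1 => prodUp ω n * matA (ω n)

/-- `A_k A_{k-1} ⋯ A_1` -/
noncomputable def prodDown (ω : Env) : ℕ → Matrix (Fin 3) (Fin 3) ℝ
  | 0 => 1
  | k + 1 => matA (ω ((k : ℤ) + 1)) * prodDown ω k

/-- `γ` is the top Lyapunov exponent of `A_0, A_1, …` under `envLaw ν`: almost surely
`n⁻¹ log ‖A_0 ⋯ A_{n-1}‖ → γ`, where `‖M‖ = ∑ |M i j|` (the choice of norm is immaterial). -/
def IsTopLyapunovExponent (ν : ProbabilityMeasure SiteLaw) (γ : ℝ) : Prop :=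
  ∀ᵐ ω ∂(envLaw ν),
    Tendsto (fun n : ℕ => (n : ℝ)⁻¹ * Real.log (∑ i, ∑ j, |prodUp ω n i j|)) atTop (𝓝 γ)

/-- `π(ω) = 1 + ∑_{k ≥ 1} e₁ A_k ⋯ A_1 (2,1,2)ᵗ`, with values in `[0,∞]`. -/
noncomputable def hittingSeries (ω : Env) : ENNReal :=
  1 + ∑' k : ℕ, ENNReal.ofReal ((prodDown ω (k + 1)).mulVec ![2, 1, 2] 0)

section Conditions

variable {d : ℕ} {Θ : Set (EuclideanSpace ℝ (Fin d))}

/-- `inf_θ E^θ log ω_0(l) > -∞` for the three jumps `l`. As `log 0 = 0` here, the usual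
convention `log 0 = -∞` is made explicit by the almost sure positivity. -/
def LogMoment (ν : Θ → ProbabilityMeasure SiteLaw) : Prop :=
  ∀ p ∈ ({left2, left1, right1} : Set (SiteLaw → ℝ)), ∃ C : ℝ, ∀ θ : Θ,
    (∀ᵐ w ∂(ν θ : Measure SiteLaw), 0 < p w) ∧
      Integrable (fun w => Real.log (p w)) (ν θ : Measure SiteLaw) ∧
        C ≤ ∫ w, Real.log (p w) ∂(ν θ : Measure SiteLaw)

/-- The top Lyapunov exponent is negative, i.e. the walk is transient to `+∞`. -/
def NegativeLyapunov (ν : Θ → ProbabilityMeasure SiteLaw) : Prop :=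
  ∀ θ : Θ, ∃ γ : ℝ, IsTopLyapunovExponent (ν θ) γ ∧ γ < 0

/-- `E^θ π(ω) < ∞` for all `θ`. -/
def Ballistic (ν : Θ → ProbabilityMeasure SiteLaw) : Prop :=
  ∀ θ : Θ, ∫⁻ ω, hittingSeries ω ∂(envLaw (ν θ)) < ⊤

/-- Distinct parameters are exactly those with distinct site distributions. -/
def Identifiable (ν : Θ → ProbabilityMeasure SiteLaw) : Prop :=
  ∀ θ θ' : Θ, ν θ ≠ ν θ' ↔ θ ≠ θ'

end Conditions

/-- Population vectors of the 3-type branching process. -/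
abbrev Pop : Type := Fin 3 → ℕ

/-- Offspring law of an individual whose offspring always include `c` individuals of
type 3: it gives mass `(a+b)!/(a! b!) ω(-1)^a ω(-2)^b ω(1)` to `(a,b,c)`. -/
noncomputable def offspringWith (w : SiteLaw) (c : ℕ) : Measure Pop :=
  Measure.sum fun ab : ℕ × ℕ =>
    ENNReal.ofReal ((ab.1 + ab.2).choose ab.1 * left1 w ^ ab.1 * left2 w ^ ab.2 * right1 w) •
      Measure.dirac (![ab.1, ab.2, c] : Pop)

/-- Offspring law by type: a type 2 parent (index `1`) has exactly one child of type 3, parents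
of types 1 and 3 have none. -/
noncomputable def offspring (w : SiteLaw) (i : Fin 3) : Measure Pop :=
  offspringWith w (if i = 1 then 1 else 0)

/-- Law of the sum of `n` independent random vectors with law `μ`. -/
noncomputable def convPow (μ : Measure Pop) : ℕ → Measure Pop
  | 0 => Measure.dirac 0
  | n + 1 => (convPow μ n).conv μ

/-- Quenched law of the next generation given the present one `x`, after one individual of
type 1 has immigrated. -/
noncomputable def quenchedStep (w : SiteLaw) (x : Pop) : Measure Pop :=
  ((convPow (offspring w 0) (1 + x 0)).conv (convPow (offspring w 1) (x 1))).conv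
    (convPow (offspring w 2) (x 2))

/-- Annealed transition kernel: `Q(x,{y})` is the `ν`-mean of the quenched probability. -/
noncomputable def transition (ν : ProbabilityMeasure SiteLaw) : Kernel Pop Pop :=
  Kernel.ofFunOfCountable fun x =>
    Measure.sum fun y : Pop =>
      (∫⁻ w, quenchedStep w x {y} ∂(ν : Measure SiteLaw)) • Measure.dirac y

/-- The function `φ̃_θ(z₁,z₂)`, for `ν = ν_θ`. -/
noncomputable def logWeight (ν : ProbabilityMeasure SiteLaw) (z : Pop × Pop) : ℝ :=
  Real.log (∫ w, left1 w ^ z.2 0 * left2 w ^ z.2 1 * right1 w ^ (z.1 0 + z.1 1 + z.1 2 + 1)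
    ∂(ν : Measure SiteLaw))

/-- Law of `(Z̃₀, Z̃₁)` for the chain with kernel `transition ν` and initial law `π`. -/
noncomputable def pairLaw (ν : ProbabilityMeasure SiteLaw) (π : Measure Pop) :
    Measure (Pop × Pop) :=
  π.compProd (transition ν)

/-- The limit contrast `E^*[φ̃_θ(Z̃₀, Z̃₁)]`, for `νstar = ν_{θ*}` and `ν = ν_θ`. -/
noncomputable def contrast (νstar : ProbabilityMeasure SiteLaw) (π : Measure Pop)
    (ν : ProbabilityMeasure SiteLaw) : ℝ :=
  ∫ z, logWeight ν z ∂(pairLaw νstar π)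

end RWRE

namespace RWRE

/-! ### Geometric series in two variables -/

/-! The transition probability factorises as `Q_θ(x,{y}) = K(x,y) exp φ̃_θ(x,y)`, where the
combinatorial factor `K` does not depend on `θ` (`transition_eq_coeff_mul`). Hence `l(θ*) - l(θ)` is
a stationary mean Kullback–Leibler divergence between transition laws, and Gibbs' inequality gives
`l(θ) ≤ l(θ*)`.

In case of equality the likelihood ratio is 1 at every pair charged by the stationary chain. The
empty population is charged, and from it every `(i,j,0)` can follow. So `ν_θ` and `ν_θ*` give the
same integral to `w(-1)^i w(-2)^j w(1)` for all `i`, `j`. These moments determine the measure `w(1)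
ν`, and then `ν` because `w(1) > 0` almost surely; identifiability yields `θ = θ*`
(`contrast_lt_contrast`).

The invariant law comes from Foster's criterion with the weight `V = x₁ + 2x₂ + x₃`. The drift is
geometric as soon as `S = E[ω(-1)/ω(1)] + 2E[ω(-2)/ω(1)] < 1`, and this follows from the finiteness
of `E π(ω)` through a linear recurrence for the means of its terms (`lintegral_meanWeight_lt_one`).
The same argument makes the stationary mean of `V` finite. Uniqueness holds because the empty
population is reached from every state in two steps (`invariant_unique`).

By Jensen and the log-moment bounds, `|φ̃_θ|` is at most an affine function of the two population
weights, uniformly in `θ`. So `l` is finite and, by dominated convergence, continuous; compactness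
of `Θ` turns the strict inequality into a separated one. -/

theorem tsum_prod_eq_tsum_antidiagonal (f : ℕ × ℕ → ENNReal) :
    ∑' x, f x = ∑' n, ∑ x ∈ Finset.HasAntidiagonal.antidiagonal n, f x := by
  rw [← Finset.HasAntidiagonal.sigmaAntidiagonalEquivProd.tsum_eq, ENNReal.tsum_sigma']
  refine tsum_congr fun n => ?_
  rw [tsum_fintype]
  exact Finset.sum_coe_sort (Finset.HasAntidiagonal.antidiagonal n) f

theorem sum_antidiagonal_choose (p q : ENNReal) (n : ℕ) :
    ∑ x ∈ Finset.HasAntidiagonal.antidiagonal n, ((x.1 + x.2).choose x.1 : ENNReal) * p ^ x.1 * q ^ x.2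
      = (p + q) ^ n := by
  rw [(Commute.all p q).add_pow']
  refine Finset.sum_congr rfl fun x hx => ?_
  rw [Finset.HasAntidiagonal.mem_antidiagonal.1 hx, nsmul_eq_mul, mul_assoc]

theorem tsum_choose_mul_pow (p q : ENNReal) :
    ∑' x : ℕ × ℕ, ((x.1 + x.2).choose x.1 : ENNReal) * p ^ x.1 * q ^ x.2
      = (1 - (p + q))⁻¹ := by
  rw [tsum_prod_eq_tsum_antidiagonal, ← ENNReal.tsum_geometric]
  exact tsum_congr fun n => sum_antidiagonal_choose p q n

/-- This is the Cauchy square of the geometric series: the antidiagonal of `n` has `n + 1` points.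
-/
theorem tsum_succ_mul_pow (q : ENNReal) :
    ∑' n : ℕ, ((n : ENNReal) + 1) * q ^ n = (1 - q)⁻¹ * (1 - q)⁻¹ := by
  have h := tsum_prod_eq_tsum_antidiagonal fun x => q ^ x.1 * q ^ x.2
  rw [ENNReal.tsum_prod' (f := fun x : ℕ × ℕ => q ^ x.1 * q ^ x.2)] at h
  simp only [ENNReal.tsum_mul_left, ENNReal.tsum_mul_right, ENNReal.tsum_geometric] at h
  rw [h]
  refine tsum_congr fun n => ?_
  rw [Finset.sum_congr rfl (g := fun _ => q ^ n) fun x hx => by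
    rw [← pow_add, Finset.HasAntidiagonal.mem_antidiagonal.1 hx]]
  simp

/-- The absorption identity `(i+1) C(i+1+j, i+1) = (i+j+1) C(i+j, i)` shifts the first index and
reduces the sum to `tsum_succ_mul_pow` at `p + q`. -/
theorem tsum_fst_mul_choose_mul_pow (p q : ENNReal) :
    ∑' x : ℕ × ℕ, (x.1 : ENNReal) * (((x.1 + x.2).choose x.1 : ENNReal) * p ^ x.1 * q ^ x.2)
      = p * ((1 - (p + q))⁻¹ * (1 - (p + q))⁻¹) := by
  rw [ENNReal.tsum_prod' (f := fun x : ℕ × ℕ =>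
    (x.1 : ENNReal) * (((x.1 + x.2).choose x.1 : ENNReal) * p ^ x.1 * q ^ x.2)),
    tsum_eq_zero_add' ENNReal.summable]
  simp only [Nat.cast_zero, zero_mul, tsum_zero, zero_add]
  rw [← ENNReal.tsum_prod' (f := fun x : ℕ × ℕ => (((x.1 + 1 : ℕ) : ENNReal) *
    (((x.1 + 1 + x.2).choose (x.1 + 1) : ENNReal) * p ^ (x.1 + 1) * q ^ x.2))),
    tsum_prod_eq_tsum_antidiagonal, ← tsum_succ_mul_pow, ← ENNReal.tsum_mul_left]
  refine tsum_congr fun n => ?_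
  rw [← sum_antidiagonal_choose, Finset.mul_sum, Finset.mul_sum]
  refine Finset.sum_congr rfl fun x hx => ?_
  have hc : ((x.1 + 1 : ℕ) : ENNReal) * ((x.1 + 1 + x.2).choose (x.1 + 1) : ENNReal)
      = ((n : ENNReal) + 1) * ((x.1 + x.2).choose x.1 : ENNReal) := by
    have := Nat.add_one_mul_choose_eq (x.1 + x.2) x.1
    rw [← Finset.HasAntidiagonal.mem_antidiagonal.1 hx]
    have h2 : x.1 + 1 + x.2 = (x.1 + x.2).succ := by omega
    rw [h2]
    have h3 : (((x.1 + x.2).succ * (x.1 + x.2).choose x.1 : ℕ) : ENNReal)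
      = (((x.1 + x.2).succ.choose x.1.succ * x.1.succ : ℕ) : ENNReal) := by rw [this]
    push_cast at h3 ⊢
    rw [h3, mul_comm]
  rw [mul_assoc, ← mul_assoc, hc, pow_succ]
  ring

theorem tsum_snd_mul_choose_mul_pow (p q : ENNReal) :
    ∑' x : ℕ × ℕ, (x.2 : ENNReal) * (((x.1 + x.2).choose x.1 : ENNReal) * p ^ x.1 * q ^ x.2)
      = q * ((1 - (p + q))⁻¹ * (1 - (p + q))⁻¹) := by
  rw [← (Equiv.prodComm ℕ ℕ).tsum_eq, add_comm p q, ← tsum_fst_mul_choose_mul_pow]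
  refine tsum_congr fun x => ?_
  simp only [Equiv.prodComm_apply, Prod.fst_swap, Prod.snd_swap]
  rw [add_comm x.2 x.1, Nat.choose_symm_add]
  ring

/-! ### The site law -/

theorem left2_nonneg (w : SiteLaw) : 0 ≤ left2 w := w.2.1 0
theorem left1_nonneg (w : SiteLaw) : 0 ≤ left1 w := w.2.1 1
theorem right1_nonneg (w : SiteLaw) : 0 ≤ right1 w := w.2.1 2

theorem left1_add_left2_add_right1 (w : SiteLaw) : left1 w + left2 w + right1 w = 1 := by
  have h := w.2.2
  rw [Fin.sum_univ_three] at h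
  unfold left1 left2 right1
  linarith

theorem left2_le_one (w : SiteLaw) : left2 w ≤ 1 := by
  linarith [left1_add_left2_add_right1 w, left1_nonneg w, right1_nonneg w]
theorem left1_le_one (w : SiteLaw) : left1 w ≤ 1 := by
  linarith [left1_add_left2_add_right1 w, left2_nonneg w, right1_nonneg w]
theorem right1_le_one (w : SiteLaw) : right1 w ≤ 1 := by
  linarith [left1_add_left2_add_right1 w, left2_nonneg w, left1_nonneg w]

theorem continuous_left2 : Continuous left2 :=
  (continuous_apply 0).comp continuous_subtype_val
theorem continuous_left1 : Continuous left1 :=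
  (continuous_apply 1).comp continuous_subtype_val
theorem continuous_right1 : Continuous right1 :=
  (continuous_apply 2).comp continuous_subtype_val

/-- `w(-1)^i w(-2)^j w(1)^n` -/
noncomputable def siteMonomial (i j n : ℕ) (w : SiteLaw) : ℝ :=
  left1 w ^ i * left2 w ^ j * right1 w ^ n

theorem continuous_siteMonomial (i j n : ℕ) : Continuous (siteMonomial i j n) := by
  have h1 := continuous_left1
  have h2 := continuous_left2
  have h3 := continuous_right1
  unfold siteMonomial
  fun_prop

theorem siteMonomial_nonneg (i j n : ℕ) (w : SiteLaw) : 0 ≤ siteMonomial i j n w :=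
  mul_nonneg (mul_nonneg (pow_nonneg (left1_nonneg w) _) (pow_nonneg (left2_nonneg w) _))
    (pow_nonneg (right1_nonneg w) _)

theorem siteMonomial_le_one (i j n : ℕ) (w : SiteLaw) : siteMonomial i j n w ≤ 1 :=
  mul_le_one₀ (mul_le_one₀ (pow_le_one₀ (left1_nonneg w) (left1_le_one w))
    (pow_nonneg (left2_nonneg w) _) (pow_le_one₀ (left2_nonneg w) (left2_le_one w)))
    (pow_nonneg (right1_nonneg w) _) (pow_le_one₀ (right1_nonneg w) (right1_le_one w))

theorem siteMonomial_mul (i j n i' j' n' : ℕ) (w : SiteLaw) :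
    siteMonomial i j n w * siteMonomial i' j' n' w
      = siteMonomial (i + i') (j + j') (n + n') w := by
  unfold siteMonomial; ring

/-! ### The offspring law -/

theorem inv_one_sub_ofReal (w : SiteLaw) :
    (1 - (ENNReal.ofReal (left1 w) + ENNReal.ofReal (left2 w)))⁻¹
      = (ENNReal.ofReal (right1 w))⁻¹ := by
  rw [← ENNReal.ofReal_add (left1_nonneg w) (left2_nonneg w), ← ENNReal.ofReal_one,
    ← ENNReal.ofReal_sub _ (add_nonneg (left1_nonneg w) (left2_nonneg w))]
  congr 2
  linarith [left1_add_left2_add_right1 w]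

theorem lintegral_offspringWith (w : SiteLaw) (c : ℕ) (f : Pop → ENNReal) :
    ∫⁻ y, f y ∂(offspringWith w c) = ∑' x : ℕ × ℕ, f ![x.1, x.2, c] *
      (((x.1 + x.2).choose x.1 : ENNReal) * ENNReal.ofReal (left1 w) ^ x.1
        * ENNReal.ofReal (left2 w) ^ x.2) * ENNReal.ofReal (right1 w) := by
  unfold offspringWith
  rw [lintegral_sum_measure]
  refine tsum_congr fun x => ?_
  rw [lintegral_smul_measure, lintegral_dirac, smul_eq_mul,
    ENNReal.ofReal_mul (mul_nonneg (mul_nonneg (Nat.cast_nonneg _)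
      (pow_nonneg (left1_nonneg w) _)) (pow_nonneg (left2_nonneg w) _)),
    ENNReal.ofReal_mul (mul_nonneg (Nat.cast_nonneg _) (pow_nonneg (left1_nonneg w) _)),
    ENNReal.ofReal_mul (Nat.cast_nonneg _), ENNReal.ofReal_natCast,
    ENNReal.ofReal_pow (left1_nonneg w), ENNReal.ofReal_pow (left2_nonneg w)]
  ring

/-- Positivity cannot be dropped: if `right1 w = 0`, every atom has mass zero. -/
theorem isProbabilityMeasure_offspringWith {w : SiteLaw} (hw : 0 < right1 w) (c : ℕ) :
    IsProbabilityMeasure (offspringWith w c) := by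
  constructor
  rw [← lintegral_one, lintegral_offspringWith]
  simp only [one_mul]
  rw [ENNReal.tsum_mul_right, tsum_choose_mul_pow, inv_one_sub_ofReal w]
  exact ENNReal.inv_mul_cancel (by simpa using hw) ENNReal.ofReal_ne_top

/-- The weighted population size `y₁ + 2 y₂ + y₃`. -/
def popWeight (y : Pop) : ℕ := y 0 + 2 * y 1 + y 2

theorem popWeight_add (x y : Pop) : popWeight (x + y) = popWeight x + popWeight y := by
  simp only [popWeight, Pi.add_apply]; ring

/-- The quenched mean of `popWeight` over the offspring of types 1 and 2 of an individual. -/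
noncomputable def meanWeight (w : SiteLaw) : ENNReal :=
  ENNReal.ofReal (left1 w / right1 w) + 2 * ENNReal.ofReal (left2 w / right1 w)

theorem lintegral_popWeight_offspringWith {w : SiteLaw} (hw : 0 < right1 w) (c : ℕ) :
    ∫⁻ y, (popWeight y : ENNReal) ∂(offspringWith w c) = meanWeight w + c := by
  have hr : ENNReal.ofReal (right1 w) ≠ 0 := by simpa using hw
  have hc := ENNReal.inv_mul_cancel hr ENNReal.ofReal_ne_top
  rw [lintegral_offspringWith, ENNReal.tsum_mul_right]
  have e : ∀ x : ℕ × ℕ, (popWeight ![x.1, x.2, c] : ENNReal) *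
      (((x.1 + x.2).choose x.1 : ENNReal) * ENNReal.ofReal (left1 w) ^ x.1
        * ENNReal.ofReal (left2 w) ^ x.2)
      = x.1 * (((x.1 + x.2).choose x.1 : ENNReal) * ENNReal.ofReal (left1 w) ^ x.1
        * ENNReal.ofReal (left2 w) ^ x.2)
      + 2 * (x.2 * (((x.1 + x.2).choose x.1 : ENNReal) * ENNReal.ofReal (left1 w) ^ x.1
        * ENNReal.ofReal (left2 w) ^ x.2))
      + c * (((x.1 + x.2).choose x.1 : ENNReal) * ENNReal.ofReal (left1 w) ^ x.1
        * ENNReal.ofReal (left2 w) ^ x.2) := by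
    intro x
    have : popWeight ![x.1, x.2, c] = x.1 + 2 * x.2 + c := rfl
    rw [this]
    push_cast
    ring
  simp only [e]
  rw [ENNReal.tsum_add, ENNReal.tsum_add, ENNReal.tsum_mul_left, ENNReal.tsum_mul_left,
    tsum_fst_mul_choose_mul_pow, tsum_snd_mul_choose_mul_pow, tsum_choose_mul_pow,
    inv_one_sub_ofReal w, meanWeight, ENNReal.ofReal_div_of_pos hw, ENNReal.ofReal_div_of_pos hw,
    ENNReal.div_eq_inv_mul, ENNReal.div_eq_inv_mul]
  set r := ENNReal.ofReal (right1 w)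
  set p := ENNReal.ofReal (left1 w)
  set q := ENNReal.ofReal (left2 w)
  calc (p * (r⁻¹ * r⁻¹) + 2 * (q * (r⁻¹ * r⁻¹)) + c * r⁻¹) * r
      = (p * r⁻¹ + 2 * (q * r⁻¹) + c) * (r⁻¹ * r) := by ring
    _ = r⁻¹ * p + 2 * (r⁻¹ * q) + c := by rw [hc]; ring

theorem offspringWith_singleton (w : SiteLaw) (c : ℕ) (y : Pop) :
    offspringWith w c {y} = (if y 2 = c then ((y 0 + y 1).choose (y 0) : ENNReal) else 0) *
      ENNReal.ofReal (siteMonomial (y 0) (y 1) 1 w) := by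
  rw [← lintegral_indicator_one (MeasurableSet.singleton y), lintegral_offspringWith]
  have hne : ∀ x : ℕ × ℕ, x ≠ (y 0, y 1) → (![x.1, x.2, c] : Pop) ∉ ({y} : Set Pop) := by
    rintro x hx h
    rw [Set.mem_singleton_iff] at h
    exact hx (by rw [← h]; rfl)
  rw [tsum_eq_single (y 0, y 1)]
  · have hm : (![y 0, y 1, c] : Pop) ∈ ({y} : Set Pop) ↔ y 2 = c := by
      rw [Set.mem_singleton_iff]
      constructor
      · intro h
        exact (congrFun h 2).symm
      · rintro rfl
        ext i
        fin_cases i <;> rfl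
    by_cases h : y 2 = c
    · rw [Set.indicator_of_mem (hm.2 h), if_pos h, siteMonomial, pow_one,
        ENNReal.ofReal_mul (mul_nonneg (pow_nonneg (left1_nonneg w) _)
          (pow_nonneg (left2_nonneg w) _)),
        ENNReal.ofReal_mul (pow_nonneg (left1_nonneg w) _), ENNReal.ofReal_pow (left1_nonneg w),
        ENNReal.ofReal_pow (left2_nonneg w)]
      simp only [Pi.one_apply]
      ring
    · rw [Set.indicator_of_notMem (fun h' => h (hm.1 h')), if_neg h]
      simp
  · intro x hx
    rw [Set.indicator_of_notMem (hne x hx)]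
    simp

/-! ### Convolution powers and the quenched step -/

theorem conv_singleton (μ κ : Measure Pop) [SFinite κ] (y : Pop) :
    (μ.conv κ) {y} = ∑' u : Pop, ∑' v : Pop, if u + v = y then μ {u} * κ {v} else 0 := by
  rw [← lintegral_indicator_one (MeasurableSet.singleton y),
    Measure.lintegral_conv (measurable_of_countable _), lintegral_countable']
  refine tsum_congr fun u => ?_
  rw [lintegral_countable', ← ENNReal.tsum_mul_right]
  refine tsum_congr fun v => ?_
  by_cases h : u + v = y
  · simp [h, mul_comm]
  · simp [h]

theorem mul_le_conv_singleton (μ κ : Measure Pop) [SFinite κ] (u v : Pop) :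
    μ {u} * κ {v} ≤ (μ.conv κ) {u + v} := by
  rw [conv_singleton]
  refine le_trans ?_ (ENNReal.le_tsum u)
  refine le_trans ?_ (ENNReal.le_tsum v)
  simp

theorem isProbabilityMeasure_convPow (μ : Measure Pop) [IsProbabilityMeasure μ] (n : ℕ) :
    IsProbabilityMeasure (convPow μ n) := by
  induction n with
  | zero => exact Measure.dirac.isProbabilityMeasure
  | succ n ih =>
    unfold convPow
    infer_instance

theorem lintegral_popWeight_conv (μ κ : Measure Pop) [IsProbabilityMeasure μ]
    [IsProbabilityMeasure κ] :
    ∫⁻ y, (popWeight y : ENNReal) ∂(μ.conv κ)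
      = ∫⁻ y, (popWeight y : ENNReal) ∂μ + ∫⁻ y, (popWeight y : ENNReal) ∂κ := by
  rw [Measure.lintegral_conv (measurable_of_countable _)]
  simp only [popWeight_add, Nat.cast_add]
  simp_rw [lintegral_add_left (measurable_of_countable _)]
  simp

theorem lintegral_popWeight_convPow (μ : Measure Pop) [IsProbabilityMeasure μ] (n : ℕ) :
    ∫⁻ y, (popWeight y : ENNReal) ∂(convPow μ n) = n * ∫⁻ y, (popWeight y : ENNReal) ∂μ := by
  induction n with
  | zero => simp [convPow, popWeight]
  | succ n ih =>
    have := isProbabilityMeasure_convPow μ n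
    rw [convPow, lintegral_popWeight_conv, ih]
    push_cast
    ring

/-- The mass function of `μ w` is a coefficient free of `w` times a monomial of degree `n`
in `w(1)`. -/
def HasMonomialMass (μ : SiteLaw → Measure Pop) (n : ℕ) (K : Pop → ENNReal) : Prop :=
  ∀ w, 0 < right1 w → ∀ y,
    μ w {y} = K y * ENNReal.ofReal (siteMonomial (y 0) (y 1) n w)

/-- Exponents add along `u + v = y`, so one common monomial factors out of the convolution sum and
leaves a coefficient free of `w`. -/
theorem HasMonomialMass.conv {μ κ : SiteLaw → Measure Pop} {m n : ℕ} {K K' : Pop → ENNReal}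
    (hμ : HasMonomialMass μ m K) (hκ : HasMonomialMass κ n K')
    (hp : ∀ w, 0 < right1 w → IsProbabilityMeasure (κ w)) :
    ∃ K'', HasMonomialMass (fun w => (μ w).conv (κ w)) (m + n) K'' := by
  refine ⟨fun y => ∑' u : Pop, ∑' v : Pop, if u + v = y then K u * K' v else 0,
    fun w hw y => ?_⟩
  have := hp w hw
  rw [conv_singleton, ← ENNReal.tsum_mul_right]
  refine tsum_congr fun u => ?_
  rw [← ENNReal.tsum_mul_right]
  refine tsum_congr fun v => ?_
  by_cases h : u + v = y
  · rw [if_pos h, if_pos h, hμ w hw, hκ w hw, ← h, Pi.add_apply, Pi.add_apply,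
      ← siteMonomial_mul, ENNReal.ofReal_mul (siteMonomial_nonneg _ _ _ _)]
    ring
  · rw [if_neg h, if_neg h, zero_mul]

theorem exists_hasMonomialMass_convPow (i : Fin 3) (n : ℕ) :
    ∃ K, HasMonomialMass (fun w => convPow (offspring w i) n) n K := by
  induction n with
  | zero =>
    refine ⟨fun y => if y = 0 then 1 else 0, fun w _ y => ?_⟩
    simp only [convPow]
    rw [Measure.dirac_apply' _ (MeasurableSet.singleton y)]
    by_cases h : y = 0
    · simp [h, siteMonomial]
    · simp [h, Ne.symm h]
  | succ n ih =>
    obtain ⟨K, hK⟩ := ih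
    exact hK.conv (K' := fun y => if y 2 = (if i = 1 then 1 else 0) then
      ((y 0 + y 1).choose (y 0) : ENNReal) else 0)
      (fun w _ y => offspringWith_singleton w _ y)
      fun w hw => isProbabilityMeasure_offspringWith hw _

theorem isProbabilityMeasure_convPow_offspring {w : SiteLaw} (hw : 0 < right1 w) (i : Fin 3)
    (n : ℕ) : IsProbabilityMeasure (convPow (offspring w i) n) :=
  have : IsProbabilityMeasure (offspring w i) := isProbabilityMeasure_offspringWith hw _
  isProbabilityMeasure_convPow _ n

theorem isProbabilityMeasure_quenchedStep {w : SiteLaw} (hw : 0 < right1 w) (x : Pop) :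
    IsProbabilityMeasure (quenchedStep w x) := by
  have := isProbabilityMeasure_convPow_offspring hw
  unfold quenchedStep
  infer_instance

/-- The exponent of `w(1)` in the transition from `x`: the number of reproducing individuals. -/
def parents (x : Pop) : ℕ := x 0 + x 1 + x 2 + 1

/-- Each reproducing individual, the immigrant included, contributes one factor `w(1)`. Since `K` is
chosen before `w`, it survives averaging over any site law. -/
theorem exists_hasMonomialMass_quenchedStep (x : Pop) :
    ∃ K, HasMonomialMass (fun w => quenchedStep w x) (parents x) K := by
  obtain ⟨K0, h0⟩ := exists_hasMonomialMass_convPow 0 (1 + x 0)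
  obtain ⟨K1, h1⟩ := exists_hasMonomialMass_convPow 1 (x 1)
  obtain ⟨K2, h2⟩ := exists_hasMonomialMass_convPow 2 (x 2)
  obtain ⟨K3, h3⟩ := h0.conv h1 fun w hw => isProbabilityMeasure_convPow_offspring hw _ _
  obtain ⟨K4, h4⟩ := h3.conv h2 fun w hw => isProbabilityMeasure_convPow_offspring hw _ _
  have e : 1 + x 0 + x 1 + x 2 = parents x := by unfold parents; ring
  rw [e] at h4
  exact ⟨K4, h4⟩

/-- The extra term `x 1` counts the certain type 3 children of type 2 parents. The weight 2 of such
a parent pays for this child of weight 1, which is why `popWeight` can contract. -/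
theorem lintegral_popWeight_quenchedStep {w : SiteLaw} (hw : 0 < right1 w) (x : Pop) :
    ∫⁻ y, (popWeight y : ENNReal) ∂(quenchedStep w x) = parents x * meanWeight w + x 1 := by
  have h := isProbabilityMeasure_convPow_offspring hw
  have h' : ∀ i, IsProbabilityMeasure (offspring w i) :=
    fun i => isProbabilityMeasure_offspringWith hw _
  have hm : ∀ i, ∫⁻ y, (popWeight y : ENNReal) ∂(offspring w i)
      = meanWeight w + ((if i = 1 then 1 else 0 : ℕ) : ENNReal) :=
    fun i => lintegral_popWeight_offspringWith hw _
  rw [quenchedStep, lintegral_popWeight_conv, lintegral_popWeight_conv,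
    lintegral_popWeight_convPow, lintegral_popWeight_convPow, lintegral_popWeight_convPow,
    hm, hm, hm, parents]
  simp
  ring

theorem pow_le_convPow_singleton (μ : Measure Pop) [IsProbabilityMeasure μ] (y : Pop) (n : ℕ) :
    μ {y} ^ n ≤ convPow μ n {n • y} := by
  induction n with
  | zero => simp [convPow]
  | succ n ih =>
    rw [convPow, pow_succ, succ_nsmul]
    exact (mul_le_mul_left ih _).trans (mul_le_conv_singleton _ _ _ _)

/-- A generation may leave no children of types 1 and 2. -/
theorem quenchedStep_childless_pos {w : SiteLaw} (hw : 0 < right1 w) (x : Pop) :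
    quenchedStep w x {![0, 0, x 1]} ≠ 0 := by
  have h := isProbabilityMeasure_convPow_offspring hw
  have h' : ∀ i, IsProbabilityMeasure (offspring w i) :=
    fun i => isProbabilityMeasure_offspringWith hw _
  have hr : ENNReal.ofReal (right1 w) ≠ 0 := by simpa using hw
  -- All `n` individuals have the least possible offspring, each with probability `w(1) > 0`.
  have key : ∀ i n, convPow (offspring w i) n
      {![0, 0, n * (if i = 1 then 1 else 0)]} ≠ 0 := by
    intro i n
    have h1 := pow_le_convPow_singleton (offspring w i) ![0, 0, if i = 1 then 1 else 0] n
    have h2 : n • (![0, 0, if i = 1 then 1 else 0] : Pop)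
        = ![0, 0, n * (if i = 1 then 1 else 0)] := by
      simp
    rw [h2] at h1
    refine fun h0 => ?_
    rw [h0, nonpos_iff_eq_zero] at h1
    have h3 := eq_zero_of_pow_eq_zero h1
    rw [offspring, offspringWith_singleton] at h3
    simp [siteMonomial] at h3
    exact absurd h3 (not_le.2 hw)
  have k0 := key 0 (1 + x 0)
  have k1 := key 1 (x 1)
  have k2 := key 2 (x 2)
  have e : (![0, 0, x 1] : Pop) = ![0, 0, (1 + x 0) * (if (0 : Fin 3) = 1 then 1 else 0)]
      + ![0, 0, x 1 * (if (1 : Fin 3) = 1 then 1 else 0)]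
      + ![0, 0, x 2 * (if (2 : Fin 3) = 1 then 1 else 0)] := by
    simp
  rw [e, quenchedStep]
  refine fun h0 => ?_
  have h1 := mul_le_conv_singleton
    ((convPow (offspring w 0) (1 + x 0)).conv (convPow (offspring w 1) (x 1)))
    (convPow (offspring w 2) (x 2))
    (![0, 0, (1 + x 0) * (if (0 : Fin 3) = 1 then 1 else 0)]
      + ![0, 0, x 1 * (if (1 : Fin 3) = 1 then 1 else 0)])
    ![0, 0, x 2 * (if (2 : Fin 3) = 1 then 1 else 0)]
  rw [h0, nonpos_iff_eq_zero, mul_eq_zero, or_iff_left k2] at h1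
  have h2 := mul_le_conv_singleton (convPow (offspring w 0) (1 + x 0))
    (convPow (offspring w 1) (x 1)) ![0, 0, (1 + x 0) * (if (0 : Fin 3) = 1 then 1 else 0)]
    ![0, 0, x 1 * (if (1 : Fin 3) = 1 then 1 else 0)]
  rw [h1, nonpos_iff_eq_zero, mul_eq_zero, or_iff_left k1] at h2
  exact k0 h2

/-- From the empty population any number of children of types 1 and 2 may be born. -/
theorem quenchedStep_zero_singleton (w : SiteLaw) {y : Pop} (hy : y 2 = 0) :
    quenchedStep w 0 {y}
      = ((y 0 + y 1).choose (y 0) : ENNReal) * ENNReal.ofReal (siteMonomial (y 0) (y 1) 1 w) := by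
  -- The immigrant is the only parent.
  have e : quenchedStep w 0 = offspring w 0 := by
    have hs : SFinite (offspring w 0) := by
      unfold offspring offspringWith
      infer_instance
    simp [quenchedStep, convPow]
  rw [e, offspring, offspringWith_singleton]
  simp [hy]

/-! ### The annealed transition kernel -/

theorem transition_apply_singleton (ν : ProbabilityMeasure SiteLaw) (x y : Pop) :
    transition ν x {y} = ∫⁻ w, quenchedStep w x {y} ∂(ν : Measure SiteLaw) := by
  change (Measure.sum fun y : Pop =>
      (∫⁻ w, quenchedStep w x {y} ∂(ν : Measure SiteLaw)) • Measure.dirac y) {y} = _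
  rw [Measure.sum_apply _ (MeasurableSet.singleton y), tsum_eq_single y]
  · simp
  · intro z hz
    simp [hz]

/-- Measurability in `w` is read off the monomial form, which is available only where `right1 w >
0`. -/
theorem aemeasurable_quenchedStep_singleton {ν : ProbabilityMeasure SiteLaw}
    (hr : ∀ᵐ w ∂(ν : Measure SiteLaw), 0 < right1 w) (x y : Pop) :
    AEMeasurable (fun w => quenchedStep w x {y}) (ν : Measure SiteLaw) := by
  obtain ⟨K, hK⟩ := exists_hasMonomialMass_quenchedStep x
  refine ⟨fun w => K y * ENNReal.ofReal (siteMonomial (y 0) (y 1) (parents x) w), ?_, ?_⟩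
  · exact ((continuous_siteMonomial _ _ _).measurable.ennreal_ofReal).const_mul _
  · filter_upwards [hr] with w hw using hK w hw y

theorem lintegral_transition {ν : ProbabilityMeasure SiteLaw}
    (hr : ∀ᵐ w ∂(ν : Measure SiteLaw), 0 < right1 w) (x : Pop) (f : Pop → ENNReal) :
    ∫⁻ y, f y ∂(transition ν x)
      = ∫⁻ w, ∫⁻ y, f y ∂(quenchedStep w x) ∂(ν : Measure SiteLaw) := by
  simp_rw [lintegral_countable', transition_apply_singleton]
  rw [lintegral_tsum fun y => (aemeasurable_quenchedStep_singleton hr x y).const_mul _]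
  refine tsum_congr fun y => ?_
  rw [lintegral_const_mul'' _ (aemeasurable_quenchedStep_singleton hr x y)]

theorem isMarkovKernel_transition {ν : ProbabilityMeasure SiteLaw}
    (hr : ∀ᵐ w ∂(ν : Measure SiteLaw), 0 < right1 w) : IsMarkovKernel (transition ν) := by
  refine ⟨fun x => ⟨?_⟩⟩
  rw [← lintegral_one, lintegral_transition hr,
    lintegral_congr_ae (g := fun _ => 1) ?_]
  · simp
  · filter_upwards [hr] with w hw
    have := isProbabilityMeasure_quenchedStep hw x
    simp

theorem lintegral_popWeight_transition {ν : ProbabilityMeasure SiteLaw}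
    (hr : ∀ᵐ w ∂(ν : Measure SiteLaw), 0 < right1 w) (x : Pop) :
    ∫⁻ y, (popWeight y : ENNReal) ∂(transition ν x)
      = parents x * ∫⁻ w, meanWeight w ∂(ν : Measure SiteLaw) + x 1 := by
  have hm : Measurable meanWeight := by
    have h1 := continuous_left1.measurable
    have h2 := continuous_left2.measurable
    have h3 := continuous_right1.measurable
    unfold meanWeight
    fun_prop
  rw [lintegral_transition hr, lintegral_congr_ae (g := fun w => parents x * meanWeight w + x 1)]
  · rw [lintegral_add_right _ measurable_const, lintegral_const_mul _ hm]
    simp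
  · filter_upwards [hr] with w hw using lintegral_popWeight_quenchedStep hw x

/-- `∫ w(-1)^{z'₁} w(-2)^{z'₂} w(1)^{z₁+z₂+z₃+1} ν(dw)` -/
noncomputable def annealedWeight (ν : ProbabilityMeasure SiteLaw) (z : Pop × Pop) : ℝ :=
  ∫ w, siteMonomial (z.2 0) (z.2 1) (parents z.1) w ∂(ν : Measure SiteLaw)

theorem logWeight_eq (ν : ProbabilityMeasure SiteLaw) (z : Pop × Pop) :
    logWeight ν z = Real.log (annealedWeight ν z) := rfl

theorem integrable_siteMonomial (ν : ProbabilityMeasure SiteLaw) (i j n : ℕ) :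
    Integrable (siteMonomial i j n) (ν : Measure SiteLaw) :=
  Integrable.of_bound (continuous_siteMonomial i j n).aestronglyMeasurable 1
    (Eventually.of_forall fun w => by
      rw [Real.norm_of_nonneg (siteMonomial_nonneg _ _ _ _)]
      exact siteMonomial_le_one _ _ _ _)

theorem annealedWeight_nonneg (ν : ProbabilityMeasure SiteLaw) (z : Pop × Pop) :
    0 ≤ annealedWeight ν z :=
  integral_nonneg fun w => siteMonomial_nonneg _ _ _ w

theorem annealedWeight_le_one (ν : ProbabilityMeasure SiteLaw) (z : Pop × Pop) :
    annealedWeight ν z ≤ 1 := by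
  have h := integral_mono (integrable_siteMonomial ν (z.2 0) (z.2 1) (parents z.1))
    (integrable_const (1 : ℝ)) fun w => siteMonomial_le_one _ _ _ w
  simpa [annealedWeight] using h

/-- The combinatorial factor of the transition from `z.1` to `z.2`. -/
noncomputable def transitionCoeff (z : Pop × Pop) : ENNReal :=
  (exists_hasMonomialMass_quenchedStep z.1).choose z.2

theorem quenchedStep_singleton {w : SiteLaw} (hw : 0 < right1 w) (x y : Pop) :
    quenchedStep w x {y} = transitionCoeff (x, y)
      * ENNReal.ofReal (siteMonomial (y 0) (y 1) (parents x) w) :=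
  (exists_hasMonomialMass_quenchedStep x).choose_spec w hw y

/-- The coefficient does not involve `ν`, so ratios of transition probabilities under two site laws
are ratios of annealed weights. -/
theorem transition_eq_coeff_mul {ν : ProbabilityMeasure SiteLaw}
    (hr : ∀ᵐ w ∂(ν : Measure SiteLaw), 0 < right1 w) (x y : Pop) :
    transition ν x {y} = transitionCoeff (x, y) * ENNReal.ofReal (annealedWeight ν (x, y)) := by
  rw [transition_apply_singleton, lintegral_congr_ae (g := fun w => transitionCoeff (x, y)
      * ENNReal.ofReal (siteMonomial (y 0) (y 1) (parents x) w)),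
    lintegral_const_mul _ (continuous_siteMonomial _ _ _).measurable.ennreal_ofReal,
    annealedWeight, ofReal_integral_eq_lintegral_ofReal (integrable_siteMonomial _ _ _ _)
      (Eventually.of_forall fun w => siteMonomial_nonneg _ _ _ w)]
  filter_upwards [hr] with w hw using quenchedStep_singleton hw x y

theorem annealedWeight_pos {ν : ProbabilityMeasure SiteLaw}
    (h1 : ∀ᵐ w ∂(ν : Measure SiteLaw), 0 < left1 w)
    (h2 : ∀ᵐ w ∂(ν : Measure SiteLaw), 0 < left2 w)
    (hr : ∀ᵐ w ∂(ν : Measure SiteLaw), 0 < right1 w) (z : Pop × Pop) :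
    0 < annealedWeight ν z := by
  refine lt_of_le_of_ne (annealedWeight_nonneg ν z) fun h0 => ?_
  have h := (integral_eq_zero_iff_of_nonneg (fun w => siteMonomial_nonneg _ _ _ w)
    (integrable_siteMonomial ν _ _ _)).1 h0.symm
  obtain ⟨w, hw, hw1, hw2, hwr⟩ := (h.and (h1.and (h2.and hr))).exists
  have : 0 < siteMonomial (z.2 0) (z.2 1) (parents z.1) w := by
    unfold siteMonomial; positivity
  exact this.ne' hw

theorem transition_childless_ne_zero {ν : ProbabilityMeasure SiteLaw}
    (hr : ∀ᵐ w ∂(ν : Measure SiteLaw), 0 < right1 w) (x : Pop) :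
    transition ν x {![0, 0, x 1]} ≠ 0 := by
  rw [transition_apply_singleton, Ne,
    lintegral_eq_zero_iff' (aemeasurable_quenchedStep_singleton hr _ _)]
  intro h
  obtain ⟨w, hw, hwr⟩ := (h.and hr).exists
  exact quenchedStep_childless_pos hwr x hw

/-- The empty population is reached from everywhere in two steps. -/
theorem exists_transition_transition_zero {ν : ProbabilityMeasure SiteLaw}
    (hr : ∀ᵐ w ∂(ν : Measure SiteLaw), 0 < right1 w) (x : Pop) :
    ∃ y, transition ν x {y} ≠ 0 ∧ transition ν y {0} ≠ 0 := by
  -- After one childless generation only type 3 individuals remain; they have no certain child, so a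
  -- second such generation is empty.
  refine ⟨_, transition_childless_ne_zero hr x, ?_⟩
  have h := transition_childless_ne_zero hr ![0, 0, x 1]
  have e : (![0, 0, (![0, 0, x 1] : Pop) 1] : Pop) = 0 := by
    ext i; fin_cases i <;> rfl
  rwa [e] at h

theorem transition_zero_ne_zero {ν : ProbabilityMeasure SiteLaw}
    (h1 : ∀ᵐ w ∂(ν : Measure SiteLaw), 0 < left1 w)
    (h2 : ∀ᵐ w ∂(ν : Measure SiteLaw), 0 < left2 w)
    (hr : ∀ᵐ w ∂(ν : Measure SiteLaw), 0 < right1 w) {y : Pop} (hy : y 2 = 0) :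
    transition ν 0 {y} ≠ 0 := by
  rw [transition_apply_singleton, Ne,
    lintegral_eq_zero_iff' (aemeasurable_quenchedStep_singleton hr _ _)]
  intro h
  obtain ⟨w, hw, hw1, hw2, hwr⟩ := (h.and (h1.and (h2.and hr))).exists
  simp only [quenchedStep_zero_singleton w hy, Pi.zero_apply] at hw
  have hp : 0 < siteMonomial (y 0) (y 1) 1 w := by unfold siteMonomial; positivity
  have hc : 0 < (y 0 + y 1).choose (y 0) := Nat.choose_pos (Nat.le_add_right _ _)
  simp at hw
  rcases hw with hw | hw
  · omega
  · exact absurd hw (not_le.2 hp)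
/-! ### Markov kernels on a countable space: invariant probability measures -/

section Countable

variable {α : Type*} [MeasurableSpace α]

/-- A zero of an invariant vector propagates backwards along possible transitions, since all terms
of a vanishing sum vanish. -/
theorem eq_zero_of_invariant_of_apply_eq_zero {Q : Kernel α α} {m : α → ENNReal}
    (hm : ∀ y, ∑' x, m x * Q x {y} = m y) {o : α} (h0 : m o = 0) {x y : α}
    (hxy : Q x {y} ≠ 0) (hyo : Q y {o} ≠ 0) : m x = 0 := by
  have step : ∀ {a b}, m b = 0 → Q a {b} ≠ 0 → m a = 0 := by
    intro a b hb hab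
    rw [← hm b, ENNReal.tsum_eq_zero] at hb
    exact (mul_eq_zero.1 (hb a)).resolve_right hab
  exact step (step h0 hyo) hxy

/-- The law at time `n` of the chain started at `o`. -/
noncomputable def chainLaw (Q : Kernel α α) (o : α) : ℕ → Measure α
  | 0 => Measure.dirac o
  | n + 1 => (chainLaw Q o n).bind Q

theorem isProbabilityMeasure_chainLaw (Q : Kernel α α) [IsMarkovKernel Q] (o : α) (n : ℕ) :
    IsProbabilityMeasure (chainLaw Q o n) := by
  induction n with
  | zero => exact Measure.dirac.isProbabilityMeasure
  | succ n ih => unfold chainLaw; infer_instance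

variable [Countable α] [MeasurableSingletonClass α]

theorem bind_kernel_singleton (π : Measure α) (Q : Kernel α α) (y : α) :
    π.bind Q {y} = ∑' x, π {x} * Q x {y} := by
  rw [Measure.bind_apply (MeasurableSet.singleton y) Q.aemeasurable, lintegral_countable']
  exact tsum_congr fun x => mul_comm _ _

theorem tsum_kernel_singleton (Q : Kernel α α) [IsMarkovKernel Q] (x : α) :
    ∑' y, Q x {y} = 1 := by
  have h := lintegral_countable' (μ := Q x) fun _ => 1
  simpa using h.symm

theorem tsum_measure_singleton (π : Measure α) [IsProbabilityMeasure π] :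
    ∑' y, π {y} = 1 := by
  have h := lintegral_countable' (μ := π) fun _ => 1
  simpa using h.symm

/-- A finite row vector that loses mass nowhere under a Markov kernel is invariant. -/
theorem tsum_mul_kernel_eq_of_le (Q : Kernel α α) [IsMarkovKernel Q] {m : α → ENNReal}
    (hfin : ∑' x, m x ≠ ⊤) (h : ∀ y, ∑' x, m x * Q x {y} ≤ m y) (y : α) :
    ∑' x, m x * Q x {y} = m y := by
  -- Rows of `Q` sum to one, so both vectors have the same finite total mass and a strict inequality
  -- at one point is impossible.
  have hs : ∑' y, ∑' x, m x * Q x {y} = ∑' x, m x := by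
    rw [ENNReal.tsum_comm]
    refine tsum_congr fun x => ?_
    rw [ENNReal.tsum_mul_left, tsum_kernel_singleton, mul_one]
  by_contra hne
  have := ENNReal.tsum_lt_tsum (by rw [hs]; exact hfin) h (lt_of_le_of_ne (h y) hne)
  exact this.ne hs

/-- The pointwise minimum `m` of the two laws satisfies `mQ ≤ m`, hence is invariant. One of the
laws agrees with `m` at `o`; its excess over `m` is invariant and vanishes at `o`, hence everywhere.
So one law lies below the other, and equal total mass makes them equal. -/
theorem invariant_unique {Q : Kernel α α} [IsMarkovKernel Q] {o : α}
    (hQ : ∀ x, ∃ y, Q x {y} ≠ 0 ∧ Q y {o} ≠ 0) {π π' : Measure α} [IsProbabilityMeasure π]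
    [IsProbabilityMeasure π'] (hπ : Q.Invariant π) (hπ' : Q.Invariant π') : π = π' := by
  have hi : ∀ {μ : Measure α}, Q.Invariant μ → ∀ y, ∑' x, μ {x} * Q x {y} = μ {y} := by
    intro μ hμ y
    rw [← bind_kernel_singleton, hμ.def]
  set m : α → ENNReal := fun x => min (π {x}) (π' {x}) with hmdef
  have hsum : ∑' x, m x ≠ ⊤ := by
    refine ne_top_of_le_ne_top ENNReal.one_ne_top ?_
    rw [← tsum_measure_singleton π]
    exact ENNReal.tsum_le_tsum fun x => min_le_left _ _
  have hm : ∀ y, ∑' x, m x * Q x {y} = m y := by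
    refine tsum_mul_kernel_eq_of_le Q hsum fun y => le_min ?_ ?_
    · rw [← hi hπ y]
      exact ENNReal.tsum_le_tsum fun x => mul_le_mul_left (min_le_left _ _) _
    · rw [← hi hπ' y]
      exact ENNReal.tsum_le_tsum fun x => mul_le_mul_left (min_le_right _ _) _
  have key : ∀ {μ : Measure α} [IsProbabilityMeasure μ], Q.Invariant μ → (∀ x, m x ≤ μ {x}) →
      m o = μ {o} → ∀ x, μ {x} = m x := by
    intro μ _ hμ hle ho x
    have hd : ∀ y, ∑' x, (μ {x} - m x) * Q x {y} = μ {y} - m y := by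
      intro y
      have hmy : ∑' x, m x * Q x {y} ≠ ⊤ := by
        rw [hm]; exact ne_top_of_le_ne_top (measure_ne_top μ _) (hle y)
      rw [hm] at hmy
      refine ENNReal.eq_sub_of_add_eq hmy ?_
      rw [← hi hμ y, ← hm y, ← ENNReal.tsum_add]
      exact tsum_congr fun x => by rw [← add_mul, tsub_add_cancel_of_le (hle x)]
    obtain ⟨y, hxy, hyo⟩ := hQ x
    have h0 := eq_zero_of_invariant_of_apply_eq_zero hd (by rw [ho, tsub_self]) hxy hyo
    exact le_antisymm (tsub_eq_zero_iff_le.1 h0) (hle x)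
  have total : ∀ {μ κ : Measure α} [IsProbabilityMeasure μ] [IsProbabilityMeasure κ],
      (∀ x, μ {x} ≤ κ {x}) → ∀ x, μ {x} = κ {x} := by
    intro μ κ _ _ hle x
    by_contra hne
    have := ENNReal.tsum_lt_tsum (by rw [tsum_measure_singleton]; exact ENNReal.one_ne_top)
      hle (lt_of_le_of_ne (hle x) hne)
    rw [tsum_measure_singleton, tsum_measure_singleton] at this
    exact lt_irrefl _ this
  refine Measure.ext_of_singleton fun x => ?_
  rcases min_choice (π {o}) (π' {o}) with h | h
  · refine total (fun x => ?_) x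
    rw [key hπ (fun x => min_le_left _ _) h x]
    exact min_le_right _ _
  · refine (total (fun x => ?_) x).symm
    rw [key hπ' (fun x => min_le_right _ _) h x]
    exact min_le_left _ _

/-- The level `D` is stable under `t ↦ ρ t + C`, so the bound propagates from each time to the next.
-/
theorem lintegral_chainLaw_le (Q : Kernel α α) [IsMarkovKernel Q] {V : α → ENNReal}
    {ρ C D : ENNReal} (hV : ∀ x, ∫⁻ y, V y ∂(Q x) ≤ ρ * V x + C) (hD : ρ * D + C ≤ D) {o : α}
    (ho : V o ≤ D) (n : ℕ) : ∫⁻ y, V y ∂(chainLaw Q o n) ≤ D := by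
  induction n with
  | zero =>
    rw [chainLaw, lintegral_dirac]
    exact ho
  | succ n ih =>
    have := isProbabilityMeasure_chainLaw Q o n
    rw [chainLaw, Measure.lintegral_bind Q.aemeasurable
      (measurable_of_countable V).aemeasurable]
    calc ∫⁻ x, ∫⁻ y, V y ∂(Q x) ∂(chainLaw Q o n)
        ≤ ∫⁻ x, (ρ * V x + C) ∂(chainLaw Q o n) := lintegral_mono hV
      _ = ρ * ∫⁻ x, V x ∂(chainLaw Q o n) + C := by
        rw [lintegral_add_right _ measurable_const,
          lintegral_const_mul _ (measurable_of_countable V)]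
        simp
      _ ≤ ρ * D + C := by gcongr
      _ ≤ D := hD

/-- Mean occupation of `y` during the first `N + 1` steps. -/
noncomputable def occupation (Q : Kernel α α) (o : α) (N : ℕ) (y : α) : ENNReal :=
  ((N : ENNReal) + 1)⁻¹ * ∑ n ∈ Finset.range (N + 1), chainLaw Q o n {y}

theorem tsum_occupation_mul_le (Q : Kernel α α) (o : α) (N : ℕ) {V : α → ENNReal} {D : ENNReal}
    (h : ∀ n, ∫⁻ y, V y ∂(chainLaw Q o n) ≤ D) : ∑' y, occupation Q o N y * V y ≤ D := by
  have e : ∀ y, occupation Q o N y * V y = ((N : ENNReal) + 1)⁻¹ *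
      ∑ n ∈ Finset.range (N + 1), V y * chainLaw Q o n {y} := by
    intro y
    rw [occupation, mul_assoc, Finset.sum_mul]
    simp only [mul_comm (V y)]
  simp_rw [e]
  rw [ENNReal.tsum_mul_left, Summable.tsum_finsetSum fun _ _ => ENNReal.summable]
  calc ((N : ENNReal) + 1)⁻¹ * ∑ n ∈ Finset.range (N + 1), ∑' y, V y * chainLaw Q o n {y}
      ≤ ((N : ENNReal) + 1)⁻¹ * ∑ n ∈ Finset.range (N + 1), D := by
        gcongr with n
        rw [← lintegral_countable']
        exact h n
    _ = (((N : ENNReal) + 1)⁻¹ * ((N : ENNReal) + 1)) * D := by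
        rw [Finset.sum_const, Finset.card_range, nsmul_eq_mul]
        push_cast
        ring
    _ = D := by
        rw [ENNReal.inv_mul_cancel (by simp) (by simp), one_mul]

theorem tsum_occupation (Q : Kernel α α) [IsMarkovKernel Q] (o : α) (N : ℕ) :
    ∑' y, occupation Q o N y = 1 := by
  have := isProbabilityMeasure_chainLaw Q o
  simp_rw [occupation]
  rw [ENNReal.tsum_mul_left, Summable.tsum_finsetSum fun _ _ => ENNReal.summable]
  simp_rw [tsum_measure_singleton]
  rw [Finset.sum_const, Finset.card_range, nsmul_eq_mul, mul_one]
  push_cast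
  exact ENNReal.inv_mul_cancel (by simp) (by simp)

/-- One step of the chain shifts the time window by one; only the new last term, of mass at most
one, has to be added. -/
theorem tsum_occupation_mul_kernel_le (Q : Kernel α α) [IsMarkovKernel Q] (o : α) (N : ℕ)
    (y : α) : ∑' x, occupation Q o N x * Q x {y}
      ≤ occupation Q o N y + ((N : ENNReal) + 1)⁻¹ := by
  have := isProbabilityMeasure_chainLaw Q o
  have e : ∀ x, occupation Q o N x * Q x {y} = ((N : ENNReal) + 1)⁻¹ *
      ∑ n ∈ Finset.range (N + 1), chainLaw Q o n {x} * Q x {y} := by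
    intro x
    rw [occupation, mul_assoc, Finset.sum_mul]
  simp_rw [e]
  rw [ENNReal.tsum_mul_left, Summable.tsum_finsetSum fun _ _ => ENNReal.summable]
  simp_rw [← bind_kernel_singleton]
  change ((N : ENNReal) + 1)⁻¹ * ∑ n ∈ Finset.range (N + 1), chainLaw Q o (n + 1) {y} ≤ _
  rw [occupation, ← mul_add_one]
  gcongr
  calc ∑ n ∈ Finset.range (N + 1), chainLaw Q o (n + 1) {y}
      ≤ ∑ n ∈ Finset.range (N + 1 + 1), chainLaw Q o n {y} := by
        rw [Finset.sum_range_succ' _ (N + 1)]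
        exact le_self_add
    _ ≤ _ := by
        rw [Finset.sum_range_succ]
        gcongr
        exact prob_le_one

/-- Foster's criterion: a geometric drift condition for a proper function `V` gives an invariant
probability measure for which `V` has finite mean. -/
theorem exists_invariant_of_drift (Q : Kernel α α) [IsMarkovKernel Q] {V : α → ℕ}
    (hfin : ∀ R : ℕ, {x | V x ≤ R}.Finite) {ρ C D : ENNReal}
    (hV : ∀ x, ∫⁻ y, (V y : ENNReal) ∂(Q x) ≤ ρ * V x + C) (hD : ρ * D + C ≤ D) (hDtop : D ≠ ⊤)
    {o : α} (ho : (V o : ENNReal) ≤ D) :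
    ∃ π : Measure α, IsProbabilityMeasure π ∧ Q.Invariant π ∧
      ∫⁻ y, (V y : ENNReal) ∂π ≤ D := by
  classical
  have hchain := lintegral_chainLaw_le Q hV hD ho
  -- The space `[0,∞]^α` is compact, so the occupation vectors converge pointwise along a
  -- nonprincipal ultrafilter; no subsequence is extracted.
  let U : Ultrafilter (α → ENNReal) := Ultrafilter.map (occupation Q o) (hyperfilter ℕ)
  set m : α → ENNReal := U.lim with hm
  have hU : Tendsto (occupation Q o) (hyperfilter ℕ : Filter ℕ) (𝓝 m) := U.le_nhds_lim
  have hlim : ∀ x, Tendsto (fun N => occupation Q o N x) (hyperfilter ℕ : Filter ℕ) (𝓝 (m x)) :=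
    fun x => tendsto_pi_nhds.1 hU x
  have hinv : Tendsto (fun N : ℕ => ((N : ENNReal) + 1)⁻¹) (hyperfilter ℕ : Filter ℕ) (𝓝 0) := by
    have h := (tendsto_add_atTop_iff_nat 1).2 ENNReal.tendsto_inv_nat_nhds_zero
    refine Tendsto.mono_left ?_ Nat.hyperfilter_le_atTop
    simpa using h
  -- Finite partial sums pass to the limit; finiteness of `f` is what makes multiplication by `f x`
  -- continuous on `[0,∞]`.
  have fatou : ∀ (f : α → ENNReal), (∀ x, f x ≠ ⊤) → ∀ (c : ℕ → ENNReal) (B : ENNReal),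
      Tendsto c (hyperfilter ℕ : Filter ℕ) (𝓝 B) →
      (∀ N, ∑' x, occupation Q o N x * f x ≤ c N) → ∑' x, m x * f x ≤ B := by
    intro f hf c B hc hle
    rw [ENNReal.tsum_eq_iSup_sum]
    refine iSup_le fun s => ?_
    refine le_of_tendsto_of_tendsto
      (tendsto_finsetSum s fun x _ => ENNReal.Tendsto.mul_const (hlim x) (Or.inr (hf x))) hc
      (Eventually.of_forall fun N => ?_)
    exact (ENNReal.sum_le_tsum s).trans (hle N)
  have hle1 : ∑' x, m x ≤ 1 := by
    have := fatou (fun _ => 1) (fun _ => ENNReal.one_ne_top) (fun _ => 1) 1 tendsto_const_nhds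
      fun N => by simp [tsum_occupation]
    simpa using this
  -- No mass escapes: by Markov's inequality the occupation of `{V > R}` is at most `D / (R + 1)`
  -- for every `N`, and `{V ≤ R}` is finite.
  have hge1 : 1 ≤ ∑' x, m x := by
    have hR : ∀ R : ℕ, 1 ≤ ∑' x, m x + D / ((R : ENNReal) + 1) := by
      intro R
      have hN : ∀ N, 1 ≤ ∑ x ∈ (hfin R).toFinset, occupation Q o N x
          + D / ((R : ENNReal) + 1) := by
        intro N
        have hsplit : ∀ x, occupation Q o N x ≤
            (if x ∈ (hfin R).toFinset then occupation Q o N x else 0)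
              + ((R : ENNReal) + 1)⁻¹ * (occupation Q o N x * V x) := by
          intro x
          by_cases hx : x ∈ (hfin R).toFinset
          · rw [if_pos hx]; exact le_self_add
          · rw [if_neg hx, zero_add]
            have hx' : R + 1 ≤ V x := by
              simpa using hx
            have hx2 : ((R : ENNReal) + 1) ≤ V x := by exact_mod_cast hx'
            calc occupation Q o N x
                = ((R : ENNReal) + 1)⁻¹ * ((R : ENNReal) + 1) * occupation Q o N x := by
                  rw [ENNReal.inv_mul_cancel (by simp) (by simp), one_mul]
              _ ≤ ((R : ENNReal) + 1)⁻¹ * V x * occupation Q o N x := by gcongr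
              _ = _ := by ring
        calc 1 = ∑' x, occupation Q o N x := (tsum_occupation Q o N).symm
          _ ≤ _ := ENNReal.tsum_le_tsum hsplit
          _ ≤ _ := by
            rw [ENNReal.tsum_add, ENNReal.tsum_mul_left, ENNReal.div_eq_inv_mul]
            gcongr
            · rw [tsum_eq_sum (s := (hfin R).toFinset) fun x hx => if_neg hx]
              exact (Finset.sum_congr rfl fun x hx => if_pos hx).le
            · exact tsum_occupation_mul_le Q o N hchain
      refine (ge_of_tendsto' ((tendsto_finsetSum (hfin R).toFinset
        fun x _ => hlim x).add_const _) hN).trans ?_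
      gcongr
      exact ENNReal.sum_le_tsum _
    have ht : Tendsto (fun R : ℕ => ∑' x, m x + D / ((R : ENNReal) + 1)) atTop
        (𝓝 (∑' x, m x + D * 0)) := by
      refine Tendsto.const_add _ ?_
      have h := (tendsto_add_atTop_iff_nat 1).2 ENNReal.tendsto_inv_nat_nhds_zero
      have h2 := ENNReal.Tendsto.const_mul (a := D) h (Or.inr hDtop)
      simpa [ENNReal.div_eq_inv_mul, mul_comm] using h2
    rw [mul_zero, add_zero] at ht
    exact ge_of_tendsto' ht hR
  have hsum : ∑' x, m x = 1 := le_antisymm hle1 hge1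
  -- Fatou yields only `mQ ≤ m`; conservation of mass upgrades it to equality.
  have hQ : ∀ y, ∑' x, m x * Q x {y} = m y := by
    refine tsum_mul_kernel_eq_of_le Q (by rw [hsum]; exact ENNReal.one_ne_top) fun y => ?_
    have h := (hlim y).add hinv
    rw [add_zero] at h
    exact fatou (fun x => Q x {y}) (fun x => measure_ne_top _ _) _ _ h
      fun N => tsum_occupation_mul_kernel_le Q o N y
  let π : Measure α := Measure.sum fun x => m x • Measure.dirac x
  have hπ : ∀ y, π {y} = m y := by
    intro y
    change (Measure.sum fun x => m x • Measure.dirac x) {y} = _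
    rw [Measure.sum_apply _ (MeasurableSet.singleton y), tsum_eq_single y]
    · simp
    · intro z hz
      simp [hz]
  refine ⟨π, ⟨?_⟩, ?_, ?_⟩
  · rw [← lintegral_one, lintegral_countable']
    simpa [hπ] using hsum
  · refine Measure.ext_of_singleton fun y => ?_
    rw [bind_kernel_singleton, hπ, ← hQ y]
    simp only [hπ]
  · rw [lintegral_countable']
    simp_rw [hπ, mul_comm _ (m _)]
    exact fatou (fun x => (V x : ENNReal)) (fun x => ENNReal.natCast_ne_top _) (fun _ => D) D
      tendsto_const_nhds fun N => tsum_occupation_mul_le Q o N hchain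

end Countable

/-! ### Ballisticity bounds the mean offspring -/

theorem measurePreserving_eval_envLaw (ν : ProbabilityMeasure SiteLaw) (j : ℤ) :
    MeasurePreserving (fun ω : Env => ω j) (envLaw ν) (ν : Measure SiteLaw) :=
  measurePreserving_eval_infinitePi (fun _ : ℤ => (ν : Measure SiteLaw)) j

/-- A function of the sites in `T` is independent of the site `j ∉ T`. -/
theorem lintegral_envLaw_mul (ν : ProbabilityMeasure SiteLaw) {T : Finset ℤ} {j : ℤ} (hj : j ∉ T)
    {g : SiteLaw → ENNReal} (hg : Measurable g) {F : Env → ENNReal} (hF : Measurable F)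
    (hdep : DependsOn F (T : Set ℤ)) :
    ∫⁻ ω, g (ω j) * F ω ∂(envLaw ν)
      = (∫⁻ w, g w ∂(ν : Measure SiteLaw)) * ∫⁻ ω, F ω ∂(envLaw ν) := by
  classical
  have hw0 : Nonempty SiteLaw := (ν : Measure SiteLaw).nonempty_of_neZero
  obtain ⟨w0⟩ := hw0
  have hind : iIndepFun (fun (i : ℤ) (ω : Env) => ω i) (envLaw ν) :=
    iIndepFun_infinitePi (P := fun _ : ℤ => (ν : Measure SiteLaw)) (X := fun _ w => w)
      fun _ => measurable_id
  have h2 := hind.indepFun_finset {j} T (by simpa using hj) fun i => measurable_pi_apply i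
  -- Filling the sites outside `T` with `w0` writes `F` as a measurable function of the coordinates
  -- in `T`.
  let ext : (T → SiteLaw) → Env := fun r i => if h : i ∈ T then r ⟨i, h⟩ else w0
  have hext : Measurable ext := by
    refine measurable_pi_lambda _ fun i => ?_
    by_cases h : i ∈ T
    · simpa [ext, h] using measurable_pi_apply _
    · simp [ext, h]
  have h3 := h2.comp (φ := fun r => g (r ⟨j, Finset.mem_singleton_self j⟩))
    (ψ := fun r => F (ext r)) (by fun_prop) (hF.comp hext)
  have hFe : ∀ ω : Env, F (ext fun i => ω i) = F ω := fun ω =>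
    hdep fun i hi => by simp [ext, Finset.mem_coe.1 hi]
  have h4 : IndepFun (fun ω : Env => g (ω j)) F (envLaw ν) := by
    have e : ((fun r => F (ext r)) ∘ fun (ω : Env) (i : T) => ω i) = F := funext hFe
    rw [e] at h3
    exact h3
  have he : Measurable fun ω : Env => ω j := by fun_prop
  have hgm : AEMeasurable (fun ω : Env => g (ω j)) (envLaw ν) := (hg.comp he).aemeasurable
  rw [lintegral_mul_eq_lintegral_mul_lintegral_of_indepFun'' hgm hF.aemeasurable h4,
    (measurePreserving_eval_envLaw ν j).lintegral_comp hg]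

/-- `A_k ⋯ A_1 (2,1,2)ᵗ` -/
noncomputable def hittingVec (k : ℕ) (ω : Env) : Fin 3 → ℝ :=
  (prodDown ω k).mulVec ![2, 1, 2]

theorem hittingVec_zero (ω : Env) : hittingVec 0 ω = ![2, 1, 2] := by
  simp [hittingVec, prodDown]

theorem hittingVec_succ (k : ℕ) (ω : Env) :
    hittingVec (k + 1) ω = (matA (ω ((k : ℤ) + 1))).mulVec (hittingVec k ω) := by
  rw [hittingVec, prodDown, ← Matrix.mulVec_mulVec, hittingVec]

theorem hittingVec_succ_zero (k : ℕ) (ω : Env) :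
    hittingVec (k + 1) ω 0
      = left1 (ω ((k : ℤ) + 1)) / right1 (ω ((k : ℤ) + 1)) * hittingVec k ω 0
        + left2 (ω ((k : ℤ) + 1)) / right1 (ω ((k : ℤ) + 1)) * hittingVec k ω 1 := by
  rw [hittingVec_succ]
  simp [matA, Matrix.mulVec, dotProduct, Fin.sum_univ_three]

theorem hittingVec_succ_two (k : ℕ) (ω : Env) :
    hittingVec (k + 1) ω 2 = hittingVec (k + 1) ω 0 := by
  rw [hittingVec_succ]
  simp [matA, Matrix.mulVec, dotProduct, Fin.sum_univ_three]

theorem hittingVec_two (k : ℕ) (ω : Env) : hittingVec k ω 2 = hittingVec k ω 0 := by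
  cases k with
  | zero => rw [hittingVec_zero]; rfl
  | succ k => exact hittingVec_succ_two k ω

/-- The second row of `matA` is the first plus `e₃`, and the third coordinate always equals the
first. This eliminates the second coordinate from the recursion. -/
theorem hittingVec_succ_one (k : ℕ) (ω : Env) :
    hittingVec (k + 1) ω 1 = hittingVec (k + 1) ω 0 + hittingVec k ω 0 := by
  have h2 := hittingVec_two k ω
  rw [hittingVec_succ_zero, hittingVec_succ]
  simp [matA, Matrix.mulVec, dotProduct, Fin.sum_univ_three, h2]

theorem hittingVec_nonneg (k : ℕ) (ω : Env) : 0 ≤ hittingVec k ω 0 ∧ 0 ≤ hittingVec k ω 1 := by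
  induction k with
  | zero => rw [hittingVec_zero]; simp
  | succ k ih =>
    have h0 : 0 ≤ hittingVec (k + 1) ω 0 := by
      rw [hittingVec_succ_zero]
      exact add_nonneg (mul_nonneg (div_nonneg (left1_nonneg _) (right1_nonneg _)) ih.1)
        (mul_nonneg (div_nonneg (left2_nonneg _) (right1_nonneg _)) ih.2)
    exact ⟨h0, by rw [hittingVec_succ_one]; exact add_nonneg h0 ih.1⟩

theorem measurable_hittingVec (k : ℕ) :
    Measurable (fun ω => hittingVec k ω 0) ∧ Measurable (fun ω => hittingVec k ω 1) := by
  induction k with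
  | zero => simp_rw [hittingVec_zero]; exact ⟨measurable_const, measurable_const⟩
  | succ k ih =>
    have h1 := continuous_left1.measurable
    have h2 := continuous_left2.measurable
    have h3 := continuous_right1.measurable
    obtain ⟨ih0, ih1⟩ := ih
    have h0 : Measurable (fun ω => hittingVec (k + 1) ω 0) := by
      simp_rw [hittingVec_succ_zero]
      fun_prop
    refine ⟨h0, ?_⟩
    simp_rw [hittingVec_succ_one]
    exact h0.add ih0

theorem dependsOn_hittingVec (k : ℕ) :
    DependsOn (hittingVec k) (Finset.Icc (1 : ℤ) k : Set ℤ) := by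
  induction k with
  | zero => intro ω ω' _; rw [hittingVec_zero, hittingVec_zero]
  | succ k ih =>
    intro ω ω' h
    have hk : ω ((k : ℤ) + 1) = ω' ((k : ℤ) + 1) := h _ (by simp)
    rw [hittingVec_succ, hittingVec_succ, hk, ih fun i hi => h i ?_]
    simp only [Finset.coe_Icc, Set.mem_Icc] at hi ⊢
    push_cast
    omega

theorem measurable_left1_div : Measurable fun w => left1 w / right1 w :=
  continuous_left1.measurable.div continuous_right1.measurable

theorem measurable_left2_div : Measurable fun w => left2 w / right1 w :=
  continuous_left2.measurable.div continuous_right1.measurable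

/-- The new matrix uses site `k + 1`, which is independent of the sites `1, …, k` that determine
`hittingVec k`. -/
theorem lintegral_hittingVec_succ_zero (ν : ProbabilityMeasure SiteLaw) (k : ℕ) :
    ∫⁻ ω, ENNReal.ofReal (hittingVec (k + 1) ω 0) ∂(envLaw ν)
      = (∫⁻ w, ENNReal.ofReal (left1 w / right1 w) ∂(ν : Measure SiteLaw))
          * ∫⁻ ω, ENNReal.ofReal (hittingVec k ω 0) ∂(envLaw ν)
        + (∫⁻ w, ENNReal.ofReal (left2 w / right1 w) ∂(ν : Measure SiteLaw))
          * ∫⁻ ω, ENNReal.ofReal (hittingVec k ω 1) ∂(envLaw ν) := by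
  have hj : ((k : ℤ) + 1) ∉ Finset.Icc (1 : ℤ) k := by simp
  have hm := measurable_hittingVec k
  have h1 := measurable_left1_div.ennreal_ofReal
  have h2 := measurable_left2_div.ennreal_ofReal
  rw [← lintegral_envLaw_mul ν hj h1 hm.1.ennreal_ofReal
      fun ω ω' h => by rw [dependsOn_hittingVec k h],
    ← lintegral_envLaw_mul ν hj h2 hm.2.ennreal_ofReal
      fun ω ω' h => by rw [dependsOn_hittingVec k h],
    ← lintegral_add_left]
  · refine lintegral_congr fun ω => ?_
    have hn := hittingVec_nonneg k ω
    rw [hittingVec_succ_zero, ENNReal.ofReal_add, ENNReal.ofReal_mul, ENNReal.ofReal_mul]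
    · exact div_nonneg (left2_nonneg _) (right1_nonneg _)
    · exact div_nonneg (left1_nonneg _) (right1_nonneg _)
    · exact mul_nonneg (div_nonneg (left1_nonneg _) (right1_nonneg _)) hn.1
    · exact mul_nonneg (div_nonneg (left2_nonneg _) (right1_nonneg _)) hn.2
  · have he : Measurable fun ω : Env => ω ((k : ℤ) + 1) := by fun_prop
    exact (h1.comp he).mul hm.1.ennreal_ofReal

theorem lintegral_hittingVec_succ_one (ν : ProbabilityMeasure SiteLaw) (k : ℕ) :
    ∫⁻ ω, ENNReal.ofReal (hittingVec (k + 1) ω 1) ∂(envLaw ν)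
      = ∫⁻ ω, ENNReal.ofReal (hittingVec (k + 1) ω 0) ∂(envLaw ν)
        + ∫⁻ ω, ENNReal.ofReal (hittingVec k ω 0) ∂(envLaw ν) := by
  rw [← lintegral_add_left (measurable_hittingVec _).1.ennreal_ofReal]
  refine lintegral_congr fun ω => ?_
  rw [hittingVec_succ_one, ENNReal.ofReal_add (hittingVec_nonneg _ ω).1 (hittingVec_nonneg _ ω).1]

theorem tsum_lintegral_hittingVec_ne_top {ν : ProbabilityMeasure SiteLaw}
    (h : ∫⁻ ω, hittingSeries ω ∂(envLaw ν) < ⊤) :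
    ∑' k, ∫⁻ ω, ENNReal.ofReal (hittingVec (k + 1) ω 0) ∂(envLaw ν) ≠ ⊤ := by
  rw [← lintegral_tsum fun k => (measurable_hittingVec (k + 1)).1.ennreal_ofReal.aemeasurable]
  refine ne_top_of_le_ne_top h.ne (lintegral_mono fun ω => ?_)
  exact le_add_self

/-- `E[ω(-1)/ω(1)] + 2 E[ω(-2)/ω(1)] < 1` for a ballistic environment. -/
theorem lintegral_meanWeight_lt_one {ν : ProbabilityMeasure SiteLaw}
    (h1 : ∀ᵐ w ∂(ν : Measure SiteLaw), 0 < left1 w)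
    (hr : ∀ᵐ w ∂(ν : Measure SiteLaw), 0 < right1 w)
    (h : ∫⁻ ω, hittingSeries ω ∂(envLaw ν) < ⊤) :
    ∫⁻ w, meanWeight w ∂(ν : Measure SiteLaw) < 1 := by
  have hS := tsum_lintegral_hittingVec_ne_top h
  have r0 := lintegral_hittingVec_succ_zero ν
  have r1 := lintegral_hittingVec_succ_one ν
  have hpr : IsProbabilityMeasure (envLaw ν) := by unfold envLaw; infer_instance
  set p : ℕ → ENNReal := fun k => ∫⁻ ω, ENNReal.ofReal (hittingVec k ω 0) ∂(envLaw ν) with hp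
  set q : ℕ → ENNReal := fun k => ∫⁻ ω, ENNReal.ofReal (hittingVec k ω 1) ∂(envLaw ν) with hq
  have hp0 : p 0 = 2 := by simp [hp, hittingVec_zero]
  have hmean : ∫⁻ w, meanWeight w ∂(ν : Measure SiteLaw)
      = (∫⁻ w, ENNReal.ofReal (left1 w / right1 w) ∂(ν : Measure SiteLaw))
        + 2 * ∫⁻ w, ENNReal.ofReal (left2 w / right1 w) ∂(ν : Measure SiteLaw) := by
    unfold meanWeight
    rw [lintegral_add_left measurable_left1_div.ennreal_ofReal,
      lintegral_const_mul _ measurable_left2_div.ennreal_ofReal]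
  have ha : (∫⁻ w, ENNReal.ofReal (left1 w / right1 w) ∂(ν : Measure SiteLaw)) ≠ 0 := by
    rw [Ne, lintegral_eq_zero_iff measurable_left1_div.ennreal_ofReal]
    intro h0
    obtain ⟨w, hw, hw1, hwr⟩ := (h0.and (h1.and hr)).exists
    simp only [Pi.zero_apply, ENNReal.ofReal_eq_zero] at hw
    exact absurd (div_pos hw1 hwr) (not_lt.2 hw)
  rw [hmean]
  set a := ∫⁻ w, ENNReal.ofReal (left1 w / right1 w) ∂(ν : Measure SiteLaw)
  set b := ∫⁻ w, ENNReal.ofReal (left2 w / right1 w) ∂(ν : Measure SiteLaw)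
  have hrec : ∀ k, p (k + 1 + 1) = (a + b) * p (k + 1) + b * p k := by
    intro k
    have e0 : p (k + 1 + 1) = a * p (k + 1) + b * q (k + 1) := r0 (k + 1)
    have e1 : q (k + 1) = p (k + 1) + p k := r1 k
    rw [e0, e1]
    ring
  set S := ∑' k, p (k + 1) with hSdef
  have hSp : S = p 1 + ∑' k, p (k + 1 + 1) := by
    rw [hSdef, tsum_eq_zero_add' ENNReal.summable]
  have hp1 : p 1 ≠ 0 := by
    have e : p 1 = a * p 0 + b * q 0 := r0 0
    rw [e, hp0]
    simp [ha]
  -- Sum `hrec` over `k` and discard `b * p 0`. As `S` is finite and `p 1 > 0`, this excludes `a +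
  -- 2b ≥ 1`.
  have hS2 : p 1 + (a + 2 * b) * S ≤ S := by
    have hpk : ∑' k, p k = p 0 + S := tsum_eq_zero_add' ENNReal.summable
    calc p 1 + (a + 2 * b) * S ≤ p 1 + ((a + b) * S + b * (p 0 + S)) := by
          gcongr
          calc (a + 2 * b) * S = (a + b) * S + b * S := by ring
            _ ≤ _ := by gcongr; exact le_add_self
      _ = S := by
          conv_rhs => rw [hSp]
          simp_rw [hrec]
          rw [ENNReal.tsum_add, ENNReal.tsum_mul_left, ENNReal.tsum_mul_left, hpk]
  by_contra hge
  rw [not_lt] at hge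
  have h3 : p 1 + S ≤ S := by
    refine le_trans ?_ hS2
    gcongr
    exact le_mul_of_one_le_left zero_le hge
  have h4 : 0 + S < p 1 + S := ENNReal.add_lt_add_right hS (pos_iff_ne_zero.2 hp1)
  rw [zero_add] at h4
  exact absurd h3 (not_le.2 h4)

/-! ### The stationary law -/

theorem finite_popWeight_le (R : ℕ) : {x : Pop | popWeight x ≤ R}.Finite := by
  refine (Set.finite_Iic (fun _ => R : Pop)).subset fun x hx => ?_
  have hx' : x 0 + 2 * x 1 + x 2 ≤ R := hx
  intro i
  fin_cases i <;> simp <;> omega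

theorem exists_invariant_transition {ν : ProbabilityMeasure SiteLaw}
    (h1 : ∀ᵐ w ∂(ν : Measure SiteLaw), 0 < left1 w)
    (hr : ∀ᵐ w ∂(ν : Measure SiteLaw), 0 < right1 w)
    (h : ∫⁻ ω, hittingSeries ω ∂(envLaw ν) < ⊤) :
    ∃ π : Measure Pop, IsProbabilityMeasure π ∧ (transition ν).Invariant π ∧
      ∫⁻ y, (popWeight y : ENNReal) ∂π ≠ ⊤ := by
  have hs := lintegral_meanWeight_lt_one h1 hr h
  have hdrift := lintegral_popWeight_transition hr
  have := isMarkovKernel_transition hr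
  generalize ∫⁻ w, meanWeight w ∂(ν : Measure SiteLaw) = S at hs hdrift
  lift S to NNReal using hs.ne_top
  have hs' : S < 1 := by exact_mod_cast hs
  -- A type 2 individual of weight 2 leaves mean weight `S + 1`, which dictates the rate `(1 +
  -- S)/2`; types 1 and 3 leave only `S`, and the immigrant adds `S ≤ 1`.
  have hV : ∀ x, ∫⁻ y, (popWeight y : ENNReal) ∂(transition ν x)
      ≤ ((((1 + S) / 2 : NNReal)) : ENNReal) * popWeight x + 1 := by
    intro x
    rw [hdrift]
    have : (parents x : NNReal) * S + x 1 ≤ (1 + S) / 2 * popWeight x + 1 := by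
      rw [← NNReal.coe_le_coe]
      push_cast
      have hS1 : (S : ℝ) < 1 := by exact_mod_cast hs'
      have hS0 : (0 : ℝ) ≤ S := S.2
      have e1 : (parents x : ℝ) = x 0 + x 1 + x 2 + 1 := by simp [parents]
      have e2 : (popWeight x : ℝ) = x 0 + 2 * x 1 + x 2 := by simp [popWeight]
      rw [e1, e2]
      have a0 : (0 : ℝ) ≤ x 0 := Nat.cast_nonneg _
      have a2 : (0 : ℝ) ≤ x 2 := Nat.cast_nonneg _
      nlinarith [mul_nonneg (sub_nonneg.2 hS1.le) a0, mul_nonneg (sub_nonneg.2 hS1.le) a2]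
    exact_mod_cast this
  -- `D = 2 / (1 - S)` is the fixed point of `t ↦ (1 + S)/2 * t + 1`.
  obtain ⟨π, hπ, hinv, hle⟩ := exists_invariant_of_drift (transition ν) (V := popWeight)
    finite_popWeight_le (D := ((2 / (1 - S) : NNReal) : ENNReal)) (o := 0) hV (by
      have : (1 + S) / 2 * (2 / (1 - S)) + 1 ≤ 2 / (1 - S) := by
        rw [← NNReal.coe_le_coe]
        push_cast [NNReal.coe_sub hs'.le]
        have hS1 : (0 : ℝ) < 1 - S := by
          have : (S : ℝ) < 1 := by exact_mod_cast hs'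
          linarith
        apply le_of_eq
        field_simp
        ring
      exact_mod_cast this) ENNReal.coe_ne_top (by simp [popWeight])
  exact ⟨π, hπ, hinv, ne_top_of_le_ne_top ENNReal.coe_ne_top hle⟩

/-! ### Moments determine the site law -/

theorem siteLaw_ext {w w' : SiteLaw} (h1 : left1 w = left1 w') (h2 : left2 w = left2 w') :
    w = w' := by
  have h3 : right1 w = right1 w' := by
    linarith [left1_add_left2_add_right1 w, left1_add_left2_add_right1 w']
  refine Subtype.ext (funext fun i => ?_)
  fin_cases i
  · exact h2
  · exact h1
  · exact h3

/-- A Stone–Weierstrass argument: `left1` and `left2` separate points of the simplex, and the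
algebra they generate is spanned by the monomials. -/
theorem measure_eq_of_integral_siteMonomial_eq {μ μ' : Measure SiteLaw} [IsFiniteMeasure μ]
    [IsFiniteMeasure μ']
    (h : ∀ i j, ∫ w, siteMonomial i j 0 w ∂μ = ∫ w, siteMonomial i j 0 w ∂μ') : μ = μ' := by
  let f1 : BoundedContinuousFunction SiteLaw ℝ :=
    BoundedContinuousFunction.mkOfCompact ⟨left1, continuous_left1⟩
  let f2 : BoundedContinuousFunction SiteLaw ℝ :=
    BoundedContinuousFunction.mkOfCompact ⟨left2, continuous_left2⟩
  let A : StarSubalgebra ℝ (BoundedContinuousFunction SiteLaw ℝ) :=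
    { Algebra.adjoin ℝ {f1, f2} with
      star_mem' := fun {a} ha => by
        have : star a = a := by ext; simp
        rw [this]; exact ha }
  have hf1 : f1 ∈ A := Algebra.subset_adjoin (by simp)
  have hf2 : f2 ∈ A := Algebra.subset_adjoin (by simp)
  refine ext_of_forall_mem_subalgebra_integral_eq_of_pseudoEMetric_complete_countable
    (𝕜 := ℝ) (A := A) ?_ ?_
  · intro w w' hne
    by_cases h1 : left1 w = left1 w'
    · refine ⟨_, ⟨_, ⟨f2, hf2, rfl⟩, rfl⟩, fun h2 => hne (siteLaw_ext h1 h2)⟩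
    · exact ⟨_, ⟨_, ⟨f1, hf1, rfl⟩, rfl⟩, h1⟩
  · intro g hg
    have hg' : g ∈ Submodule.span ℝ (Submonoid.closure ({f1, f2} :
        Set (BoundedContinuousFunction SiteLaw ℝ)) : Set (BoundedContinuousFunction SiteLaw ℝ)) := by
      rw [← Algebra.adjoin_eq_span]
      exact hg
    clear hg
    induction hg' using Submodule.span_induction with
    | mem x hx =>
      obtain ⟨m, n, rfl⟩ := (Submonoid.mem_closure_pair _ _ _).1 hx
      have hmn := h m n
      simp only [siteMonomial, pow_zero, mul_one] at hmn
      exact hmn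
    | zero => simp
    | add x y _ _ hx hy =>
      simp only [BoundedContinuousFunction.coe_add, Pi.add_apply]
      rw [integral_add (x.integrable _) (y.integrable _),
        integral_add (x.integrable _) (y.integrable _), hx, hy]
    | smul c x _ hx =>
      simp only [BoundedContinuousFunction.coe_smul]
      rw [integral_smul, integral_smul, hx]

/-- The exponent 1 of `w(1)` is the one met in transitions out of the empty population. The moments
identify the measure with density `w(1)`, and the density can be divided out because it is almost
surely positive. -/
theorem eq_of_integral_siteMonomial_eq {ν ν' : ProbabilityMeasure SiteLaw}
    (hr : ∀ᵐ w ∂(ν : Measure SiteLaw), 0 < right1 w)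
    (hr' : ∀ᵐ w ∂(ν' : Measure SiteLaw), 0 < right1 w)
    (h : ∀ i j, ∫ w, siteMonomial i j 1 w ∂(ν : Measure SiteLaw)
      = ∫ w, siteMonomial i j 1 w ∂(ν' : Measure SiteLaw)) : ν = ν' := by
  let r : SiteLaw → ENNReal := fun w => ENNReal.ofReal (right1 w)
  have hm : Measurable r := continuous_right1.measurable.ennreal_ofReal
  have hfin : ∀ κ : ProbabilityMeasure SiteLaw,
      IsFiniteMeasure ((κ : Measure SiteLaw).withDensity r) := fun κ =>
    isFiniteMeasure_withDensity_ofReal (Integrable.of_bound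
      continuous_right1.aestronglyMeasurable 1 (Eventually.of_forall fun w => by
        rw [Real.norm_of_nonneg (right1_nonneg w)]
        exact right1_le_one w)).2
  have hint : ∀ (κ : ProbabilityMeasure SiteLaw) (i j : ℕ),
      ∫ w, siteMonomial i j 0 w ∂((κ : Measure SiteLaw).withDensity r)
        = ∫ w, siteMonomial i j 1 w ∂(κ : Measure SiteLaw) := by
    intro κ i j
    rw [integral_withDensity_eq_integral_toReal_smul hm
      (Eventually.of_forall fun w => ENNReal.ofReal_lt_top)]
    refine integral_congr_ae (Eventually.of_forall fun w => ?_)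
    simp only [r, ENNReal.toReal_ofReal (right1_nonneg w), siteMonomial, smul_eq_mul]
    ring
  have := hfin ν
  have := hfin ν'
  have hd : (ν : Measure SiteLaw).withDensity r = (ν' : Measure SiteLaw).withDensity r :=
    measure_eq_of_integral_siteMonomial_eq fun i j => by rw [hint, hint, h]
  have hinv : ∀ κ : ProbabilityMeasure SiteLaw, (∀ᵐ w ∂(κ : Measure SiteLaw), 0 < right1 w) →
      ((κ : Measure SiteLaw).withDensity r).withDensity (fun w => (r w)⁻¹) = κ := fun κ hκ =>
    withDensity_inv_same hm (by filter_upwards [hκ] with w hw; simpa [r] using hw)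
      (Eventually.of_forall fun w => ENNReal.ofReal_ne_top)
  exact Subtype.ext ((hinv ν hr).symm.trans ((congrArg
    (fun μ : Measure SiteLaw => μ.withDensity fun w => (r w)⁻¹) hd).trans (hinv ν' hr')))

/-! ### Bounds on the log-weight -/

/-- Jensen's inequality for `exp`, applied to the logarithm of the monomial. -/
theorem le_log_annealedWeight {ν : ProbabilityMeasure SiteLaw}
    (h1 : ∀ᵐ w ∂(ν : Measure SiteLaw), 0 < left1 w)
    (h2 : ∀ᵐ w ∂(ν : Measure SiteLaw), 0 < left2 w)
    (hr : ∀ᵐ w ∂(ν : Measure SiteLaw), 0 < right1 w)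
    (i1 : Integrable (fun w => Real.log (left1 w)) (ν : Measure SiteLaw))
    (i2 : Integrable (fun w => Real.log (left2 w)) (ν : Measure SiteLaw))
    (ir : Integrable (fun w => Real.log (right1 w)) (ν : Measure SiteLaw)) (z : Pop × Pop) :
    z.2 0 * ∫ w, Real.log (left1 w) ∂(ν : Measure SiteLaw)
      + z.2 1 * ∫ w, Real.log (left2 w) ∂(ν : Measure SiteLaw)
      + parents z.1 * ∫ w, Real.log (right1 w) ∂(ν : Measure SiteLaw)
      ≤ Real.log (annealedWeight ν z) := by
  let g : SiteLaw → ℝ := fun w => z.2 0 * Real.log (left1 w) + z.2 1 * Real.log (left2 w)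
    + parents z.1 * Real.log (right1 w)
  have h12 : Integrable (fun w => z.2 0 * Real.log (left1 w) + z.2 1 * Real.log (left2 w))
      (ν : Measure SiteLaw) := (i1.const_mul _).add (i2.const_mul _)
  have hg : Integrable g (ν : Measure SiteLaw) := h12.add (ir.const_mul _)
  have hexp : (Real.exp ∘ g) =ᵐ[(ν : Measure SiteLaw)]
      siteMonomial (z.2 0) (z.2 1) (parents z.1) := by
    filter_upwards [h1, h2, hr] with w hw1 hw2 hwr
    simp only [Function.comp_apply, g, siteMonomial, Real.exp_add, Real.exp_nat_mul,
      Real.exp_log hw1, Real.exp_log hw2, Real.exp_log hwr]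
  have hJ := convexOn_exp.map_integral_le (μ := (ν : Measure SiteLaw)) (f := g)
    Real.continuous_exp.continuousOn isClosed_univ (Eventually.of_forall fun _ => Set.mem_univ _)
    hg ((integrable_siteMonomial ν _ _ _).congr hexp.symm)
  have hI : ∫ w, Real.exp (g w) ∂(ν : Measure SiteLaw) = annealedWeight ν z :=
    integral_congr_ae hexp
  rw [hI] at hJ
  have hint : ∫ w, g w ∂(ν : Measure SiteLaw)
      = z.2 0 * ∫ w, Real.log (left1 w) ∂(ν : Measure SiteLaw)
      + z.2 1 * ∫ w, Real.log (left2 w) ∂(ν : Measure SiteLaw)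
      + parents z.1 * ∫ w, Real.log (right1 w) ∂(ν : Measure SiteLaw) := by
    rw [integral_add h12 (ir.const_mul _),
      integral_add (i1.const_mul _) (i2.const_mul _), integral_const_mul, integral_const_mul,
      integral_const_mul]
  rw [← hint]
  exact (Real.le_log_iff_exp_le (annealedWeight_pos h1 h2 hr z)).2 hJ

/-- The annealed weight is at most 1, so only the lower bound matters. The right side depends on `ν`
through `C` alone, hence can dominate a whole family of site laws. -/
theorem abs_logWeight_le {ν : ProbabilityMeasure SiteLaw}
    (h1 : ∀ᵐ w ∂(ν : Measure SiteLaw), 0 < left1 w)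
    (h2 : ∀ᵐ w ∂(ν : Measure SiteLaw), 0 < left2 w)
    (hr : ∀ᵐ w ∂(ν : Measure SiteLaw), 0 < right1 w)
    (i1 : Integrable (fun w => Real.log (left1 w)) (ν : Measure SiteLaw))
    (i2 : Integrable (fun w => Real.log (left2 w)) (ν : Measure SiteLaw))
    (ir : Integrable (fun w => Real.log (right1 w)) (ν : Measure SiteLaw)) {C : ℝ} (hC : 0 ≤ C)
    (c1 : -C ≤ ∫ w, Real.log (left1 w) ∂(ν : Measure SiteLaw))
    (c2 : -C ≤ ∫ w, Real.log (left2 w) ∂(ν : Measure SiteLaw))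
    (cr : -C ≤ ∫ w, Real.log (right1 w) ∂(ν : Measure SiteLaw)) (z : Pop × Pop) :
    |logWeight ν z| ≤ C * ((popWeight z.1 : ℝ) + 1 + popWeight z.2) := by
  rw [logWeight_eq, abs_of_nonpos
    (Real.log_nonpos (annealedWeight_nonneg ν z) (annealedWeight_le_one ν z))]
  have h := le_log_annealedWeight h1 h2 hr i1 i2 ir z
  have e1 : (popWeight z.1 : ℝ) = z.1 0 + 2 * z.1 1 + z.1 2 := by simp [popWeight]
  have e2 : (popWeight z.2 : ℝ) = z.2 0 + 2 * z.2 1 + z.2 2 := by simp [popWeight]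
  have e3 : (parents z.1 : ℝ) = z.1 0 + z.1 1 + z.1 2 + 1 := by simp [parents]
  have p1 := mul_le_mul_of_nonneg_left c1 (Nat.cast_nonneg (α := ℝ) (z.2 0))
  have p2 := mul_le_mul_of_nonneg_left c2 (Nat.cast_nonneg (α := ℝ) (z.2 1))
  have p3 := mul_le_mul_of_nonneg_left cr (Nat.cast_nonneg (α := ℝ) (parents z.1))
  have q1 := mul_nonneg hC (Nat.cast_nonneg (α := ℝ) (z.2 1))
  have q2 := mul_nonneg hC (Nat.cast_nonneg (α := ℝ) (z.2 2))
  have q3 := mul_nonneg hC (Nat.cast_nonneg (α := ℝ) (z.1 1))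
  rw [e3] at p3 h
  rw [e1, e2]
  linarith

/-! ### The stationary pair -/

section Pair

variable {ν : ProbabilityMeasure SiteLaw} {π : Measure Pop} [IsProbabilityMeasure π]

theorem isProbabilityMeasure_pairLaw (hr : ∀ᵐ w ∂(ν : Measure SiteLaw), 0 < right1 w) :
    IsProbabilityMeasure (pairLaw ν π) := by
  have := isMarkovKernel_transition hr
  unfold pairLaw
  infer_instance

/-- Both marginals of the pair law are `π`, the second by invariance. -/
theorem integrable_popWeight_pairLaw (hr : ∀ᵐ w ∂(ν : Measure SiteLaw), 0 < right1 w)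
    (hinv : (transition ν).Invariant π) (hfin : ∫⁻ y, (popWeight y : ENNReal) ∂π ≠ ⊤) :
    Integrable (fun z : Pop × Pop => (popWeight z.1 : ℝ) + 1 + popWeight z.2)
      (pairLaw ν π) := by
  have := isMarkovKernel_transition hr
  have hP : IsProbabilityMeasure (pairLaw ν π) := isProbabilityMeasure_pairLaw hr
  have key : ∀ f : Pop × Pop → ℕ, ∫⁻ z, (f z : ENNReal) ∂(pairLaw ν π) ≠ ⊤ →
      Integrable (fun z => (f z : ℝ)) (pairLaw ν π) := by
    intro f hf
    refine ⟨(measurable_of_countable _).aestronglyMeasurable, ?_⟩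
    rw [hasFiniteIntegral_iff_enorm]
    simpa using lt_top_iff_ne_top.2 hf
  refine ((key (fun z => popWeight z.1) ?_).add (integrable_const 1)).add
    (key (fun z => popWeight z.2) ?_)
  · rw [pairLaw, Measure.lintegral_compProd (measurable_of_countable _)]
    simpa using hfin
  · rw [pairLaw, Measure.lintegral_compProd (measurable_of_countable _)]
    rw [← hinv.def, Measure.lintegral_bind (transition ν).aemeasurable
      (measurable_of_countable _).aemeasurable] at hfin
    exact hfin

theorem invariant_zero_ne_zero (hr : ∀ᵐ w ∂(ν : Measure SiteLaw), 0 < right1 w)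
    (hinv : (transition ν).Invariant π) : π {0} ≠ 0 := by
  intro h0
  have hz : ∀ x, π {x} = 0 := by
    intro x
    obtain ⟨y, hxy, hy0⟩ := exists_transition_transition_zero hr x
    exact eq_zero_of_invariant_of_apply_eq_zero (m := fun x => π {x}) (Q := transition ν)
      (fun y => by rw [← bind_kernel_singleton, hinv.def]) h0 hxy hy0
  have := tsum_measure_singleton π
  simp [hz] at this

theorem pairLaw_zero_ne_zero (h1 : ∀ᵐ w ∂(ν : Measure SiteLaw), 0 < left1 w)
    (h2 : ∀ᵐ w ∂(ν : Measure SiteLaw), 0 < left2 w)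
    (hr : ∀ᵐ w ∂(ν : Measure SiteLaw), 0 < right1 w)
    (hinv : (transition ν).Invariant π) {y : Pop} (hy : y 2 = 0) :
    pairLaw ν π {(0, y)} ≠ 0 := by
  have := isMarkovKernel_transition hr
  rw [pairLaw, ← Set.singleton_prod_singleton, Measure.compProd_apply_prod
    (MeasurableSet.singleton _) (MeasurableSet.singleton _), lintegral_singleton]
  exact mul_ne_zero (transition_zero_ne_zero h1 h2 hr hy) (invariant_zero_ne_zero hr hinv)

/-- The likelihood ratio has mean one. -/
theorem integral_annealedWeight_div {ν' : ProbabilityMeasure SiteLaw}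
    (h1 : ∀ᵐ w ∂(ν : Measure SiteLaw), 0 < left1 w)
    (h2 : ∀ᵐ w ∂(ν : Measure SiteLaw), 0 < left2 w)
    (hr : ∀ᵐ w ∂(ν : Measure SiteLaw), 0 < right1 w)
    (hr' : ∀ᵐ w ∂(ν' : Measure SiteLaw), 0 < right1 w) :
    Integrable (fun z => annealedWeight ν' z / annealedWeight ν z) (pairLaw ν π) ∧
      ∫ z, annealedWeight ν' z / annealedWeight ν z ∂(pairLaw ν π) = 1 := by
  have := isMarkovKernel_transition hr
  have := isMarkovKernel_transition hr'
  have hnn : ∀ z, 0 ≤ annealedWeight ν' z / annealedWeight ν z := fun z =>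
    div_nonneg (annealedWeight_nonneg _ _) (annealedWeight_nonneg _ _)
  have hl : ∫⁻ z, ENNReal.ofReal (annealedWeight ν' z / annealedWeight ν z) ∂(pairLaw ν π)
      = 1 := by
    rw [pairLaw, Measure.lintegral_compProd (measurable_of_countable _)]
    -- The common coefficient turns the integrand times `transition ν x {y}` into `transition ν' x
    -- {y}`, whose sum over `y` is one.
    have inner : ∀ x, ∫⁻ y, ENNReal.ofReal (annealedWeight ν' (x, y) / annealedWeight ν (x, y))
        ∂(transition ν x) = 1 := by
      intro x
      rw [lintegral_countable', ← tsum_kernel_singleton (transition ν') x]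
      refine tsum_congr fun y => ?_
      have hp := annealedWeight_pos h1 h2 hr (x, y)
      rw [transition_eq_coeff_mul hr, transition_eq_coeff_mul hr', mul_left_comm,
        ← ENNReal.ofReal_mul (hnn _), div_mul_cancel₀ _ hp.ne']
    simp [inner]
  have hi : Integrable (fun z => annealedWeight ν' z / annealedWeight ν z) (pairLaw ν π) := by
    refine ⟨(measurable_of_countable _).aestronglyMeasurable, ?_⟩
    rw [hasFiniteIntegral_iff_ofReal (Eventually.of_forall hnn), hl]
    exact ENNReal.one_lt_top
  refine ⟨hi, ?_⟩
  rw [integral_eq_lintegral_of_nonneg_ae (Eventually.of_forall hnn) hi.1, hl,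
    ENNReal.toReal_one]

/-- Gibbs' inequality with its equality case. -/
theorem contrast_lt_contrast {ν' : ProbabilityMeasure SiteLaw}
    (h1 : ∀ᵐ w ∂(ν : Measure SiteLaw), 0 < left1 w)
    (h2 : ∀ᵐ w ∂(ν : Measure SiteLaw), 0 < left2 w)
    (hr : ∀ᵐ w ∂(ν : Measure SiteLaw), 0 < right1 w)
    (h1' : ∀ᵐ w ∂(ν' : Measure SiteLaw), 0 < left1 w)
    (h2' : ∀ᵐ w ∂(ν' : Measure SiteLaw), 0 < left2 w)
    (hr' : ∀ᵐ w ∂(ν' : Measure SiteLaw), 0 < right1 w)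
    (hinv : (transition ν).Invariant π)
    (hi : Integrable (logWeight ν) (pairLaw ν π))
    (hi' : Integrable (logWeight ν') (pairLaw ν π)) (hne : ν' ≠ ν) :
    contrast ν π ν' < contrast ν π ν := by
  have hP : IsProbabilityMeasure (pairLaw ν π) := isProbabilityMeasure_pairLaw hr
  obtain ⟨hg, hg1⟩ := integral_annealedWeight_div (π := π) h1 h2 hr hr'
  by_contra hle
  rw [not_lt] at hle
  have hpos := annealedWeight_pos h1 h2 hr
  have hpos' := annealedWeight_pos h1' h2' hr'
  -- With `r` the likelihood ratio, `D = r - 1 - log r ≥ 0`. As `r` has mean one, the integral of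
  -- `D` is the difference of the contrasts.
  let D : Pop × Pop → ℝ := fun z => annealedWeight ν' z / annealedWeight ν z - 1
    - (logWeight ν' z - logWeight ν z)
  have hlog : ∀ z, logWeight ν' z - logWeight ν z
      = Real.log (annealedWeight ν' z / annealedWeight ν z) := fun z => by
    rw [logWeight_eq, logWeight_eq, Real.log_div (hpos' z).ne' (hpos z).ne']
  have hDn : ∀ z, 0 ≤ D z := by
    intro z
    have := Real.log_le_sub_one_of_pos (div_pos (hpos' z) (hpos z))
    simp only [D, hlog]
    linarith
  have hg' : Integrable (fun z => annealedWeight ν' z / annealedWeight ν z - 1) (pairLaw ν π) :=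
    hg.sub (integrable_const 1)
  have hii : Integrable (fun z => logWeight ν' z - logWeight ν z) (pairLaw ν π) := hi'.sub hi
  have hDi : Integrable D (pairLaw ν π) := hg'.sub hii
  have hD0 : ∫ z, D z ∂(pairLaw ν π) = 0 := by
    refine le_antisymm ?_ (integral_nonneg hDn)
    have e : ∫ z, D z ∂(pairLaw ν π) = contrast ν π ν - contrast ν π ν' := by
      change ∫ z, (annealedWeight ν' z / annealedWeight ν z - 1
        - (logWeight ν' z - logWeight ν z)) ∂(pairLaw ν π) = _
      rw [integral_sub hg' hii,
        integral_sub hg (integrable_const 1), integral_sub hi' hi, hg1]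
      simp [contrast]
    rw [e]
    linarith
  have hae := (integral_eq_zero_iff_of_nonneg hDn hDi).1 hD0
  refine hne (eq_of_integral_siteMonomial_eq hr' hr fun i j => ?_)
  -- An almost sure identity on a countable space holds at each charged atom, and strict concavity
  -- of `log` then forces ratio 1 there.
  have hz := ae_iff_of_countable.1 hae ((0 : Pop), (![i, j, 0] : Pop))
    (pairLaw_zero_ne_zero h1 h2 hr hinv rfl)
  have heq : annealedWeight ν' (0, ![i, j, 0]) / annealedWeight ν (0, ![i, j, 0]) = 1 := by
    by_contra hne1
    have := Real.log_lt_sub_one_of_pos (div_pos (hpos' _) (hpos _)) hne1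
    simp only [D, hlog, Pi.zero_apply] at hz
    linarith
  exact (div_eq_one_iff_eq (hpos _).ne').1 heq

end Pair

/-! ### Continuity in the parameter and conclusion -/

theorem continuous_annealedWeight {X : Type*} [TopologicalSpace X]
    {ν : X → ProbabilityMeasure SiteLaw} (hν : Continuous ν) (z : Pop × Pop) :
    Continuous fun θ => annealedWeight (ν θ) z := by
  refine continuous_iff_continuousAt.2 fun θ => ?_
  exact ProbabilityMeasure.tendsto_iff_forall_integral_tendsto.1 hν.continuousAt
    (BoundedContinuousFunction.mkOfCompact ⟨_, continuous_siteMonomial _ _ _⟩)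

end RWRE

theorem mainTheorem6 {d : ℕ} (hd : 1 ≤ d) (Θ : Set (EuclideanSpace ℝ (Fin d)))
    (hΘ : IsCompact Θ) (ν : Θ → ProbabilityMeasure RWRE.SiteLaw)
    (θstar : Θ) (hstar : (θstar : EuclideanSpace ℝ (Fin d)) ∈ interior Θ)
    (h1 : RWRE.LogMoment ν) (h2 : RWRE.NegativeLyapunov ν) (h3 : RWRE.Ballistic ν)
    (h4 : Continuous ν) (h5 : RWRE.Identifiable ν) :
    ∃ π : Measure RWRE.Pop,
      -- `π` is the unique invariant probability measure of the chain under the true parameter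
      (IsProbabilityMeasure π ∧ (RWRE.transition (ν θstar)).Invariant π ∧
        ∀ π' : Measure RWRE.Pop, IsProbabilityMeasure π' →
          (RWRE.transition (ν θstar)).Invariant π' → π' = π) ∧
      -- the contrast is a well-defined finite expectation
      (∀ θ : Θ, Integrable (RWRE.logWeight (ν θ)) (RWRE.pairLaw (ν θstar) π)) ∧
      (∀ ε : ℝ, 0 < ε →
        (⨆ θ : Θ, ⨆ _ : ε ≤ ‖(θ : EuclideanSpace ℝ (Fin d)) - θstar‖,
            (RWRE.contrast (ν θstar) π (ν θ) : EReal))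
          < (RWRE.contrast (ν θstar) π (ν θstar) : EReal)) ∧
      (∀ θ : Θ, θ ≠ θstar →
        RWRE.contrast (ν θstar) π (ν θ) < RWRE.contrast (ν θstar) π (ν θstar)) := by
  obtain ⟨C1, hC1⟩ := h1 RWRE.left1 (by simp)
  obtain ⟨C2, hC2⟩ := h1 RWRE.left2 (by simp)
  obtain ⟨Cr, hCr⟩ := h1 RWRE.right1 (by simp)
  have p1 := fun θ => (hC1 θ).1
  have p2 := fun θ => (hC2 θ).1
  have pr := fun θ => (hCr θ).1
  obtain ⟨π, hπ, hinv, hfin⟩ :=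
    RWRE.exists_invariant_transition (p1 θstar) (pr θstar) (h3 θstar)
  have hbound := RWRE.integrable_popWeight_pairLaw (pr θstar) hinv hfin
  -- The log-moment bounds are uniform in `θ`, so one `C` gives both integrability and the
  -- dominating function for continuity.
  obtain ⟨C, hC0, c1, c2, cr⟩ : ∃ C : ℝ, 0 ≤ C ∧ -C ≤ C1 ∧ -C ≤ C2 ∧ -C ≤ Cr :=
    ⟨|C1| + |C2| + |Cr|, by positivity,
      by linarith [neg_abs_le C1, abs_nonneg C2, abs_nonneg Cr],
      by linarith [neg_abs_le C2, abs_nonneg C1, abs_nonneg Cr],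
      by linarith [neg_abs_le Cr, abs_nonneg C1, abs_nonneg C2]⟩
  have habs : ∀ θ z, ‖RWRE.logWeight (ν θ) z‖
      ≤ C * ((RWRE.popWeight z.1 : ℝ) + 1 + RWRE.popWeight z.2) := fun θ =>
    RWRE.abs_logWeight_le (p1 θ) (p2 θ) (pr θ) (hC1 θ).2.1 (hC2 θ).2.1 (hCr θ).2.1 hC0
      (c1.trans (hC1 θ).2.2) (c2.trans (hC2 θ).2.2) (cr.trans (hCr θ).2.2)
  have hint : ∀ θ, Integrable (RWRE.logWeight (ν θ)) (RWRE.pairLaw (ν θstar) π) := fun θ =>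
    (hbound.const_mul C).mono' (measurable_of_countable _).aestronglyMeasurable
      (Eventually.of_forall (habs θ))
  have hlt : ∀ θ : Θ, θ ≠ θstar →
      RWRE.contrast (ν θstar) π (ν θ) < RWRE.contrast (ν θstar) π (ν θstar) := fun θ hθ =>
    RWRE.contrast_lt_contrast (p1 θstar) (p2 θstar) (pr θstar) (p1 θ) (p2 θ) (pr θ) hinv
      (hint θstar) (hint θ) ((h5 θ θstar).2 hθ)
  have hcont : Continuous fun θ => RWRE.contrast (ν θstar) π (ν θ) :=
    continuous_of_dominated (fun θ => (hint θ).1) (fun θ => Eventually.of_forall (habs θ))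
      (hbound.const_mul C) (Eventually.of_forall fun z =>
        (RWRE.continuous_annealedWeight h4 z).log fun θ =>
          (RWRE.annealedWeight_pos (p1 θ) (p2 θ) (pr θ) z).ne')
  refine ⟨π, ⟨hπ, hinv, fun π' hπ' hinv' => ?_⟩, hint, fun ε hε => ?_, hlt⟩
  · have := RWRE.isMarkovKernel_transition (pr θstar)
    exact RWRE.invariant_unique (RWRE.exists_transition_transition_zero (pr θstar)) hinv' hinv
  · have : CompactSpace Θ := isCompact_iff_compactSpace.1 hΘ
    have hK : IsCompact {θ : Θ | ε ≤ ‖(θ : EuclideanSpace ℝ (Fin d)) - θstar‖} :=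
      (isClosed_le continuous_const (by fun_prop)).isCompact
    rcases Set.eq_empty_or_nonempty {θ : Θ | ε ≤ ‖(θ : EuclideanSpace ℝ (Fin d)) - θstar‖}
      with hempty | hne
    · refine lt_of_le_of_lt (iSup₂_le fun θ hθ => ?_) (EReal.bot_lt_coe _)
      exact absurd (show θ ∈ {θ : Θ | ε ≤ ‖(θ : EuclideanSpace ℝ (Fin d)) - θstar‖} from hθ)
        (hempty ▸ Set.notMem_empty θ)
    -- The supremum is attained at some `θ₀`, which differs from `θstar` because `ε > 0`.
    · obtain ⟨θ₀, hθ₀, hmax⟩ := hK.exists_isMaxOn hne hcont.continuousOn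
      refine lt_of_le_of_lt (iSup₂_le fun θ hθ => EReal.coe_le_coe_iff.2 (hmax hθ))
        (EReal.coe_lt_coe_iff.2 (hlt θ₀ fun h => ?_))
      rw [Set.mem_ofPred_eq, h, sub_self, norm_zero] at hθ₀
      exact absurd hε (not_lt.2 hθ₀)
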